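/- A lattice is a finitely generated free $\mathbb Z$-module $L$ with a positive definite symmetric bilinear form $B:L\times L\to\mathbb Z$; write $Q(x)=B(x,x)$. A lattice $L$ represents a lattice $M$ if there is a $\mathbb Z$-linear map $\sigma:M\to L$ with $Q(\sigma(x))=Q(x)$ for all $x\in M$. An isolation of a lattice $\ell$ is a lattice that represents every proper sublattice of $\ell$ (of any rank) but does not represent $\ell$ itself; $\mathrm{Iso}(\ell)$ denotes the minimum rank of the isolations of $\ell$ ($\infty$ if there are none). Let $I_n=\mathbb Z^n$ with the standard dot product, let $D_n=\{a\in\mathbb Z^n: a_1+\dots+a_n\text{ is even}\}$ and $A_{n-1}=\{a\in\mathbb Z^n: a_1+\dots+a_n=0\}$ with the restricted forms, and let $\perp$ denote the orthogonal sum. Theorem. Let $n\ge 2$ be an integer, let $t$ be the number of primes less than $\sqrt{n/2}$, and let $s=\max(t-1,0)$. Then every isolation of $I_n$ represents $$I_{n-1}\perp D_n\perp \underbrace{A_{n-1}\perp\dots\perp A_{n-1}}_{s\text{ copies}}.$$ In particular, $\mathrm{Iso}(I_n)\ge 2n-1+(n-1)s$. Hence $\mathrm{Iso}(I_n)\in\Omega(n^{\frac32-\epsilon})$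 for every $\epsilon>0$; that is, for every $\epsilon>0$ there is a constant $C>0$ such that $C\,n^{\frac32-\epsilon}\le \mathrm{Iso}(I_n)$ for all sufficiently large $n$. -/

import Mathlib

/-- A positive definite integral lattice: a finitely generated abelian group with a symmetric
`ℤ`-valued bilinear form that is positive definite. (Positive definiteness makes the group
torsion-free, hence free of finite rank.) -/
structure PosDefLattice where
  carrier : Type
  [addCommGroup : AddCommGroup carrier]
  [finite : Module.Finite ℤ carrier]
  form : LinearMap.BilinForm ℤ carrier
  symm : ∀ x y, form x y = form y x
  pos : ∀ x, x ≠ 0 → 0 < form x x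

namespace PosDefLattice

attribute [instance] PosDefLattice.addCommGroup PosDefLattice.finite

/-- The rank of a lattice. -/
noncomputable def rank (L : PosDefLattice) : ℕ := Module.finrank ℤ L.carrier

/-- `L.Represents M`: there is a linear map `σ : M → L` with `Q(σ x) = Q(x)` for all `x ∈ M`. -/
def Represents (L M : PosDefLattice) : Prop :=
  ∃ σ : M.carrier →ₗ[ℤ] L.carrier, ∀ x, L.form (σ x) (σ x) = M.form x x

/-- A subgroup of a lattice, with the restricted form. -/
noncomputable abbrev sublattice (L : PosDefLattice) (N : Submodule ℤ L.carrier) : PosDefLattice where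
  carrier := N
  form := L.form.compl₁₂ N.subtype N.subtype
  symm x y := L.symm x y
  pos x hx := L.pos x (fun h => hx (Subtype.ext h))

/-- The orthogonal sum `L ⊥ M`. -/
noncomputable abbrev orthSum (L M : PosDefLattice) : PosDefLattice where
  carrier := L.carrier × M.carrier
  form := L.form.compl₁₂ (LinearMap.fst ℤ L.carrier M.carrier) (LinearMap.fst ℤ L.carrier M.carrier)
    + M.form.compl₁₂ (LinearMap.snd ℤ L.carrier M.carrier) (LinearMap.snd ℤ L.carrier M.carrier)
  symm x y := by simp [L.symm x.1 y.1, M.symm x.2 y.2]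
  pos x hx := by
    have nonneg : ∀ (K : PosDefLattice) (z : K.carrier), 0 ≤ K.form z z := fun K z => by
      by_cases h : z = 0
      · simp [h]
      · exact (K.pos z h).le
    simp only [LinearMap.add_apply, LinearMap.compl₁₂_apply, LinearMap.fst_apply,
      LinearMap.snd_apply]
    by_cases h : x.1 = 0
    · have h2 : x.2 ≠ 0 := fun h2 => hx (Prod.ext h h2)
      linarith [nonneg L x.1, M.pos _ h2]
    · linarith [nonneg M x.2, L.pos _ h]

/-- The orthogonal sum `L ⊥ ⋯ ⊥ L` of `k` copies of `L`. -/
noncomputable abbrev copies (k : ℕ) (L : PosDefLattice) : PosDefLattice where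
  carrier := Fin k → L.carrier
  form := ∑ i : Fin k, L.form.compl₁₂
    (LinearMap.proj (R := ℤ) (φ := fun _ : Fin k => L.carrier) i)
    (LinearMap.proj (R := ℤ) (φ := fun _ : Fin k => L.carrier) i)
  symm x y := by
    simp only [LinearMap.sum_apply, LinearMap.compl₁₂_apply, LinearMap.proj_apply]
    exact Finset.sum_congr rfl fun i _ => L.symm _ _
  pos x hx := by
    simp only [LinearMap.sum_apply, LinearMap.compl₁₂_apply, LinearMap.proj_apply]
    obtain ⟨j, hj⟩ := Function.ne_iff.mp hx
    refine Finset.sum_pos' (fun i _ => ?_) ⟨j, Finset.mem_univ j, L.pos _ hj⟩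
    by_cases h : x i = 0
    · simp [h]
    · exact (L.pos _ h).le

/-- The cubic lattice `I_n`: the group `ℤⁿ` with the standard dot product. -/
noncomputable abbrev cubic (n : ℕ) : PosDefLattice where
  carrier := Fin n → ℤ
  form := LinearMap.mk₂ ℤ (fun x y => ∑ i, x i * y i)
    (fun x y z => by simp [add_mul, Finset.sum_add_distrib])
    (fun c x y => by simp [Finset.mul_sum, mul_assoc])
    (fun x y z => by simp [mul_add, Finset.sum_add_distrib])
    (fun c x y => by simp [Finset.mul_sum, mul_left_comm])
  symm x y := by simp [mul_comm]
  pos x hx := by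
    simp only [LinearMap.mk₂_apply]
    obtain ⟨j, hj⟩ := Function.ne_iff.mp hx
    exact Finset.sum_pos' (fun i _ => mul_self_nonneg _)
      ⟨j, Finset.mem_univ j, mul_self_pos.mpr hj⟩

/-- The subgroup of vectors of `ℤⁿ` with coordinate sum `0`. -/
def sumZero (n : ℕ) : Submodule ℤ (Fin n → ℤ) where
  carrier := {a | ∑ i, a i = 0}
  add_mem' {a b} ha hb := by
    simp only [Set.mem_ofPred_eq] at ha hb
    simp [Finset.sum_add_distrib, ha, hb]
  zero_mem' := by simp
  smul_mem' c a ha := by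
    simp only [Set.mem_ofPred_eq] at ha
    simp [← Finset.mul_sum, ha]

/-- The subgroup of vectors of `ℤⁿ` with even coordinate sum. -/
def sumEven (n : ℕ) : Submodule ℤ (Fin n → ℤ) where
  carrier := {a | Even (∑ i, a i)}
  add_mem' {a b} ha hb := by
    simp only [Set.mem_ofPred_eq] at ha hb
    simpa [Finset.sum_add_distrib] using ha.add hb
  zero_mem' := by simp
  smul_mem' c a ha := by
    simp only [Set.mem_ofPred_eq] at ha
    simpa [← Finset.mul_sum] using ha.mul_left c

/-- The lattice `A_m = {a ∈ ℤ^{m+1} : a_0 + ⋯ + a_m = 0}`, of rank `m`. -/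
noncomputable abbrev latticeA (m : ℕ) : PosDefLattice := (cubic (m + 1)).sublattice (sumZero (m + 1))

/-- The lattice `D_n = {a ∈ ℤⁿ : a_1 + ⋯ + a_n is even}`, of rank `n`. -/
noncomputable abbrev latticeD (n : ℕ) : PosDefLattice := (cubic n).sublattice (sumEven n)

/-- `L` is an isolation of `ℓ`: it represents every proper sublattice of `ℓ` (of any rank), but
not `ℓ` itself. -/
def IsIsolation (ℓ L : PosDefLattice) : Prop :=
  (∀ N : Submodule ℤ ℓ.carrier, N ≠ ⊤ → L.Represents (ℓ.sublattice N)) ∧ ¬ L.Represents ℓ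

/-- `Iso(ℓ)`: the minimum rank of the isolations of `ℓ` (`⊤` if `ℓ` has no isolation). -/
noncomputable def iso (ℓ : PosDefLattice) : ℕ∞ :=
  ⨅ (L : PosDefLattice) (_ : IsIsolation ℓ L), (L.rank : ℕ∞)

end PosDefLattice

/-! Write n = m + 1 and let L be an isolation of I_n. The hyperplane of vectors with last coordinate
0 gives an orthonormal family f of m vectors in L. Its span is unimodular, so L is the orthogonal
sum of that span and `orth f`, and `orth f` has no vector of norm 1, as otherwise L would represent
I_n. The other summands come from representations of proper sublattices: D_n, and for each odd prime
p with 2p² < n the vectors with coordinate sum divisible by p, which contain A_{n-1}.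

A vector of norm 2 lies in one of the two parts of L, and roots with nonzero inner product lie in
the same part. The span of f cannot contain the image of D_n, by rank (for n = 2, because 2 is not a
square), nor that of A_{n-1}, by a count of inner products (`IsOrthonormal.sub_mem_orth`). So both
land in `orth f`.

It remains to make these images mutually orthogonal. A copy of A_{n-1} consists of the edges of a
regular simplex. The vector with p ones, projected to `orth f`, is a glue vector of index p and norm
at most p. Glue vectors of coprime indices on one simplex produce a vector of norm 1
(`not_isGlue_of_coprime`), which is impossible here. Since 2p² < n, glue survives enlarging the
simplex (`IsGlue.extend`), so the simplex may be taken maximal; then every root is orthogonal to it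
or is one of its edges (`IsMaxSimplex.root`). A second simplex not orthogonal to the first would
thus be, up to translation and reflection, a face of the same maximal simplex and would carry its
own glue there: a contradiction (`IsSimplex.orthogonal`).

D_n plays the role of the prime 2: it has glue of index 2, and A_{n-1} together with its mirror
image in one coordinate generates a lattice containing 2ℤⁿ. Ranks then add up, and Chebyshev's bound
for the prime counting function gives the growth. -/

namespace PosDefLattice

variable {L : PosDefLattice}

theorem form_self_nonneg (x : L.carrier) : 0 ≤ L.form x x := by
  by_cases h : x = 0
  · simp [h]
  · exact (L.pos x h).le

theorem eq_zero_of_form_self_nonpos {x : L.carrier} (h : L.form x x ≤ 0) : x = 0 := by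
  by_contra hx
  exact absurd (L.pos x hx) (not_lt.mpr h)

theorem form_sub_self (x y : L.carrier) :
    L.form (x - y) (x - y) = L.form x x - 2 * L.form x y + L.form y y := by
  simp only [map_sub, LinearMap.sub_apply, L.symm y x]
  ring

theorem form_add_self (x y : L.carrier) :
    L.form (x + y) (x + y) = L.form x x + 2 * L.form x y + L.form y y := by
  simp only [map_add, LinearMap.add_apply, L.symm y x]
  ring

/-! ### Regular simplices of roots -/

/-- A regular simplex of squared edge length `2`; the differences of its vertices span a copy of
a root lattice of type `A`. -/
def IsSimplex (R : Finset L.carrier) : Prop :=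
  ∀ x ∈ R, ∀ y ∈ R, x ≠ y → L.form (x - y) (x - y) = 2

open Classical in
/-- `v` has norm at most `k`, and up to an additive constant its inner products with the vertices
of `R` are given by the indicator function of a set of `k` vertices. -/
def IsGlue (R : Finset L.carrier) (k : ℕ) (v : L.carrier) : Prop :=
  L.form v v ≤ k ∧ ∃ c : ℤ, ∃ U ⊆ R, U.card = k ∧
    ∀ x ∈ R, L.form v x = c + if x ∈ U then 1 else 0

namespace IsSimplex

variable {R : Finset L.carrier}

-- Only distances between vertices are prescribed, so inner products are known only in terms of the
-- norms. Everything below therefore uses combinations with coefficient sum 0, for which the norms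
-- cancel.
open Classical in
theorem two_mul_form (hR : IsSimplex R) {x y : L.carrier} (hx : x ∈ R) (hy : y ∈ R) :
    2 * L.form x y = L.form x x + L.form y y - 2 + if x = y then 2 else 0 := by
  split_ifs with h
  · subst h; ring
  · have := hR x hx y hy h
    rw [form_sub_self] at this
    linarith

open Classical in
theorem form_sub_sub (hR : IsSimplex R) {a b c d : L.carrier} (ha : a ∈ R) (hb : b ∈ R)
    (hc : c ∈ R) (hd : d ∈ R) :
    L.form (a - b) (c - d) = (if a = c then 1 else 0) - (if a = d then 1 else 0)
      - (if b = c then 1 else 0) + (if b = d then 1 else 0) := by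
  have h1 := hR.two_mul_form ha hc
  have h2 := hR.two_mul_form ha hd
  have h3 := hR.two_mul_form hb hc
  have h4 := hR.two_mul_form hb hd
  simp only [map_sub, LinearMap.sub_apply]
  split_ifs at * <;> omega

theorem form_sub_sub_of_ne (hR : IsSimplex R) {a b c : L.carrier} (ha : a ∈ R) (hb : b ∈ R)
    (hc : c ∈ R) (hab : a ≠ b) (hac : a ≠ c) (hbc : b ≠ c) : L.form (a - b) (a - c) = 1 := by
  rw [hR.form_sub_sub ha hb ha hc]
  simp [hac, hab.symm, hbc]

theorem form_combination (v : L.carrier) {z c : L.carrier → ℤ} {c₀ : ℤ}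
    (hz : ∀ x ∈ R, L.form v x = c₀ + z x) (hc : ∑ x ∈ R, c x = 0) :
    L.form v (∑ x ∈ R, c x • x) = ∑ x ∈ R, c x * z x := by
  rw [map_sum]
  have : ∀ x ∈ R, L.form v (c x • x) = c₀ * c x + c x * z x := fun x hx => by
    rw [map_smul, smul_eq_mul, hz x hx]; ring
  rw [Finset.sum_congr rfl this, Finset.sum_add_distrib, ← Finset.mul_sum, hc]
  simp

/-- For coefficients of sum 0 the vertices behave like an orthonormal basis, as in the standard
model of A_{n-1}. -/
theorem form_combination_self (hR : IsSimplex R) {c : L.carrier → ℤ} (hc : ∑ x ∈ R, c x = 0) :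
    L.form (∑ x ∈ R, c x • x) (∑ x ∈ R, c x • x) = ∑ x ∈ R, c x ^ 2 := by
  classical
  have key : ∀ x ∈ R, 2 * L.form (∑ y ∈ R, c y • y) x
      = (∑ y ∈ R, c y * L.form y y) + 2 * c x := fun x hx => by
    rw [map_sum, LinearMap.sum_apply, Finset.mul_sum]
    have h : ∀ y ∈ R, 2 * L.form (c y • y) x
        = c y * L.form y y + c y * (L.form x x - 2) + (if y = x then 2 * c y else 0) :=
      fun y hy => by
        rw [map_smul, LinearMap.smul_apply, smul_eq_mul]
        have := hR.two_mul_form hy hx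
        split_ifs at * <;> linear_combination c y * this
    rw [Finset.sum_congr rfl h, Finset.sum_add_distrib, Finset.sum_add_distrib, ← Finset.sum_mul,
      hc, Finset.sum_ite_eq' R x]
    simp [hx]
  have h2 : 2 * L.form (∑ x ∈ R, c x • x) (∑ x ∈ R, c x • x) = 2 * ∑ x ∈ R, c x ^ 2 := by
    conv_lhs => rw [map_sum, Finset.mul_sum]
    have h : ∀ x ∈ R, 2 * L.form (∑ y ∈ R, c y • y) (c x • x)
        = c x * (∑ y ∈ R, c y * L.form y y) + 2 * c x ^ 2 := fun x hx => by
      rw [map_smul, smul_eq_mul]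
      linear_combination c x * key x hx
    rw [Finset.sum_congr rfl h, Finset.sum_add_distrib, ← Finset.sum_mul, hc, ← Finset.mul_sum]
    simp
  linarith

theorem form_sub_combination_self (hR : IsSimplex R) (v : L.carrier) {z c : L.carrier → ℤ} {c₀ : ℤ}
    (hz : ∀ x ∈ R, L.form v x = c₀ + z x) (hc : ∑ x ∈ R, c x = 0) :
    L.form (v - ∑ x ∈ R, c x • x) (v - ∑ x ∈ R, c x • x)
      = L.form v v - 2 * (∑ x ∈ R, c x * z x) + ∑ x ∈ R, c x ^ 2 := by
  rw [form_sub_self, form_combination v hz hc, hR.form_combination_self hc]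

/-- The norm of a vector is at least the norm of its projection to the span of the edges of a
simplex. -/
theorem bessel (hR : IsSimplex R) (v : L.carrier) {z : L.carrier → ℤ} {c₀ : ℤ}
    (hz : ∀ x ∈ R, L.form v x = c₀ + z x) :
    R.card * ∑ x ∈ R, z x ^ 2 - (∑ x ∈ R, z x) ^ 2 ≤ R.card * L.form v v := by
  rcases Nat.eq_zero_or_pos R.card with h0 | hpos
  · rw [Finset.card_eq_zero] at h0
    simp [h0]
  set N : ℤ := (R.card : ℤ) with hN
  have hNpos : 0 < N := by rw [hN]; exact_mod_cast hpos
  set S := ∑ x ∈ R, z x with hS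
  -- The projection of `v` has coefficients `z x - S / N`; scaling by `N` keeps them integral.
  have hc : ∑ x ∈ R, (N * z x - S) = 0 := by
    rw [Finset.sum_sub_distrib, ← Finset.mul_sum]
    simp [hN, hS]
  have hz' : ∀ x ∈ R, L.form (N • v) x = N * c₀ + N * z x := fun x hx => by
    rw [map_smul, LinearMap.smul_apply, smul_eq_mul, hz x hx]; ring
  have h := hR.form_sub_combination_self (N • v) hz' hc
  have h1 : ∑ x ∈ R, (N * z x - S) * (N * z x) = N * (N * ∑ x ∈ R, z x ^ 2 - S ^ 2) := by
    have : ∀ x ∈ R, (N * z x - S) * (N * z x) = N ^ 2 * z x ^ 2 - N * S * z x := fun x _ => by ring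
    rw [Finset.sum_congr rfl this, Finset.sum_sub_distrib, ← Finset.mul_sum, ← Finset.mul_sum]
    rw [← hS]; ring
  have h2 : ∑ x ∈ R, (N * z x - S) ^ 2 = N * (N * ∑ x ∈ R, z x ^ 2 - S ^ 2) := by
    have : ∀ x ∈ R, (N * z x - S) ^ 2 = N ^ 2 * z x ^ 2 - 2 * N * S * z x + S ^ 2 :=
      fun x _ => by ring
    rw [Finset.sum_congr rfl this, Finset.sum_add_distrib, Finset.sum_sub_distrib,
      ← Finset.mul_sum, ← Finset.mul_sum, ← hS, Finset.sum_const, nsmul_eq_mul, ← hN]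
    ring
  rw [h1, h2] at h
  have h3 := form_self_nonneg (N • v - ∑ x ∈ R, (N * z x - S) • x)
  rw [h] at h3
  simp only [map_smul, LinearMap.smul_apply, smul_eq_mul] at h3
  have h4 : 0 ≤ N * (N * L.form v v - (N * ∑ x ∈ R, z x ^ 2 - S ^ 2)) := by linarith
  have := nonneg_of_mul_nonneg_right h4 hNpos
  linarith

end IsSimplex

variable {R : Finset L.carrier}

/-! ### Glue vectors -/

open Classical in
theorem sum_indicator_of_subset {U : Finset L.carrier} (hU : U ⊆ R) :
    ∑ x ∈ R, (if x ∈ U then (1 : ℤ) else 0) = U.card := by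
  rw [Finset.sum_ite_mem, Finset.inter_eq_right.mpr hU]
  simp

/-- Glue vectors of coprime indices generate a vector of norm one. -/
theorem not_isGlue_of_coprime (hL : ∀ x : L.carrier, L.form x x ≠ 1) (hR : IsSimplex R) {k l : ℕ}
    (hk : 0 < k) (hl : 0 < l) (hkl : k.Coprime l) (hcard : 2 * (k * l) < R.card)
    {v w : L.carrier} (hv : IsGlue R k v) : ¬ IsGlue R l w := by
  classical
  rintro ⟨hw1, d, V, hVR, hV, hwd⟩
  obtain ⟨hv1, c, U, hUR, hU, hvc⟩ := hv
  set z : L.carrier → ℤ := fun x => if x ∈ U then 1 else 0 with hz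
  set z' : L.carrier → ℤ := fun x => if x ∈ V then 1 else 0 with hz'
  have hsum : ∑ x ∈ R, z x = k := by rw [hz, sum_indicator_of_subset hUR, hU]
  have hsum' : ∑ x ∈ R, z' x = l := by rw [hz', sum_indicator_of_subset hVR, hV]
  have hsq : ∀ x, z x ^ 2 = z x := fun x => by simp only [hz]; split_ifs <;> norm_num
  have hsq' : ∀ x, z' x ^ 2 = z' x := fun x => by simp only [hz']; split_ifs <;> norm_num
  set m := ∑ x ∈ R, z x * z' x with hm
  set N : ℤ := (R.card : ℤ) with hN
  have hcardZ : 2 * ((k : ℤ) * l) < N := by rw [hN]; exact_mod_cast hcard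
  have hkZ : (0 : ℤ) < k := by exact_mod_cast hk
  have hlZ : (0 : ℤ) < l := by exact_mod_cast hl
  have hklZ : (0 : ℤ) < (k : ℤ) * l := mul_pos hkZ hlZ
  have hsums : ∀ a b : ℤ, ∑ x ∈ R, (a * z x + b * z' x) = a * k + b * l := fun a b => by
    rw [Finset.sum_add_distrib, ← Finset.mul_sum, ← Finset.mul_sum, hsum, hsum']
  have hsqs : ∀ a b : ℤ, ∑ x ∈ R, (a * z x + b * z' x) ^ 2
      = a ^ 2 * k + 2 * a * b * m + b ^ 2 * l := fun a b => by
    have : ∀ x ∈ R, (a * z x + b * z' x) ^ 2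
        = a ^ 2 * z x + 2 * a * b * (z x * z' x) + b ^ 2 * z' x := fun x _ => by
      linear_combination a ^ 2 * hsq x + b ^ 2 * hsq' x
    rw [Finset.sum_congr rfl this, Finset.sum_add_distrib, Finset.sum_add_distrib,
      ← Finset.mul_sum, ← Finset.mul_sum, ← Finset.mul_sum, hsum, hsum']
  have hform : ∀ a b : ℤ, L.form (a • v + b • w) (a • v + b • w)
      = a ^ 2 * L.form v v + 2 * a * b * L.form v w + b ^ 2 * L.form w w := fun a b => by
    rw [form_add_self]
    simp only [map_smul, LinearMap.smul_apply, smul_eq_mul]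
    ring
  have hpat : ∀ a b : ℤ, ∀ x ∈ R, L.form (a • v + b • w) x
      = (a * c + b * d) + (a * z x + b * z' x) := fun a b x hx => by
    simp only [map_add, map_smul, LinearMap.add_apply, LinearMap.smul_apply, smul_eq_mul,
      hvc x hx, hwd x hx, hz, hz']
    ring
  -- If the inner product were smaller than `m`, the size of U ∩ V, Bessel applied to `l • v + k •
  -- w` would give N ≤ 2kl.
  have hX : m ≤ L.form v w := by
    have h := hR.bessel _ (hpat l k)
    rw [hform, hsqs, hsums, ← hN] at h
    have hv2 : (l : ℤ) ^ 2 * L.form v v ≤ l ^ 2 * k := by gcongr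
    have hw2 : (k : ℤ) ^ 2 * L.form w w ≤ k ^ 2 * l := by gcongr
    by_contra hlt
    have h1 : L.form v w ≤ m - 1 := by omega
    have h2 : (l : ℤ) ^ 2 * L.form v v + 2 * l * k * L.form v w + k ^ 2 * L.form w w
        ≤ l ^ 2 * k + 2 * l * k * (m - 1) + k ^ 2 * l := by
      have : 2 * (l : ℤ) * k * L.form v w ≤ 2 * l * k * (m - 1) := by gcongr
      linarith
    have h3 := h.trans (mul_le_mul_of_nonneg_left h2 (by linarith : (0 : ℤ) ≤ N))
    have h4 : N * (2 * (k * l : ℤ)) ≤ 2 * (k * l) * (2 * (k * l)) := by linarith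
    have h5 := mul_lt_mul_of_pos_right hcardZ (by linarith : (0 : ℤ) < 2 * (k * l))
    linarith
  have hzero : ∑ x ∈ R, (l * z x + (-k) * z' x) = 0 := by rw [hsums]; ring
  -- This vector has norm at most 0: `l • v` and `k • w` differ by an integral combination of edges.
  have hrel : (l : ℤ) • v + (-k : ℤ) • w - ∑ x ∈ R, (l * z x + (-k) * z' x) • x = 0 := by
    apply eq_zero_of_form_self_nonpos
    rw [hR.form_sub_combination_self _ (hpat l (-k)) hzero, hform]
    have h := hsqs l (-k)
    have h2 : ∑ x ∈ R, (l * z x + (-k) * z' x) * (l * z x + (-k) * z' x)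
        = ∑ x ∈ R, (l * z x + (-k) * z' x) ^ 2 := Finset.sum_congr rfl fun x _ => by ring
    rw [h2, h]
    have hv2 : (l : ℤ) ^ 2 * L.form v v ≤ l ^ 2 * k := by gcongr
    have hw2 : (k : ℤ) ^ 2 * L.form w w ≤ k ^ 2 * l := by gcongr
    have : 2 * (l : ℤ) * k * m ≤ 2 * l * k * L.form v w := by gcongr
    linarith
  obtain ⟨x₀, hx₀R, hx₀U⟩ : ∃ x₀ ∈ R, x₀ ∉ U := by
    by_contra! hcon
    have : R.card ≤ U.card := Finset.card_le_card hcon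
    have h2 : k ≤ k * l := Nat.le_mul_of_pos_right k hl
    omega
  obtain ⟨a, b, hab⟩ : ∃ a b : ℤ, k * a + l * b = 1 := by
    obtain ⟨a, b, h⟩ := Nat.isCoprime_iff_coprime.mpr hkl
    exact ⟨a, b, by linarith⟩
  set δ : L.carrier → ℤ := fun x => if x = x₀ then 1 else 0 with hδ
  have hδs : ∑ x ∈ R, δ x = 1 := by simp [hδ, hx₀R]
  have hδz : ∀ x, δ x * z x = 0 := fun x => by
    simp only [hδ, hz]
    split_ifs with h1 h2 <;> simp
    exact hx₀U (h1 ▸ h2)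
  have hδsq : ∀ x, δ x ^ 2 = δ x := fun x => by simp only [hδ]; split_ifs <;> norm_num
  -- The coefficients `a`, `b` make a glue vector of index `k * a + l * b = 1`. Subtracting the
  -- matching edges leaves a vector whose multiple `k • u` has norm at most `k ^ 2`.
  set u := a • v + b • w - ∑ x ∈ R, (a * z x + b * z' x - δ x) • x with hu
  have hku : (k : ℤ) • u = v - ∑ x ∈ R, (z x - k * δ x) • x := by
    have e1 : v - ∑ x ∈ R, (z x - k * δ x) • x - (k : ℤ) • u
        = b • ((l : ℤ) • v + (-k : ℤ) • w - ∑ x ∈ R, (l * z x + (-k) * z' x) • x) := by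
      have hs : ∀ x ∈ R, (z x - k * δ x) • x
          = (k : ℤ) • (a * z x + b * z' x - δ x) • x + b • (l * z x + (-k) * z' x) • x :=
        fun x _ => by
          rw [smul_smul, smul_smul, ← add_smul]
          congr 1
          linear_combination (-z x) * hab
      rw [hu, Finset.sum_congr rfl hs, Finset.sum_add_distrib, ← Finset.smul_sum,
        ← Finset.smul_sum]
      have hv' : v = (k * a + l * b : ℤ) • v := by rw [hab, one_smul]
      nth_rewrite 1 [hv']
      module
    rw [hrel, smul_zero, sub_eq_zero] at e1
    exact e1.symm
  have hz0 : ∑ x ∈ R, (z x - k * δ x) = 0 := by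
    rw [Finset.sum_sub_distrib, ← Finset.mul_sum, hsum, hδs]; ring
  have hnorm : L.form ((k : ℤ) • u) ((k : ℤ) • u) = L.form v v - k + k ^ 2 := by
    rw [hku, hR.form_sub_combination_self v hvc hz0]
    have e1 : ∀ x ∈ R, (z x - k * δ x) * z x = z x := fun x _ => by
      linear_combination hsq x - k * hδz x
    have e2 : ∀ x ∈ R, (z x - k * δ x) ^ 2 = z x + k ^ 2 * δ x := fun x _ => by
      linear_combination hsq x - 2 * k * hδz x + k ^ 2 * hδsq x
    rw [Finset.sum_congr rfl e1, Finset.sum_congr rfl e2, Finset.sum_add_distrib,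
      ← Finset.mul_sum, hsum, hδs]
    ring
  have hvne : v ≠ 0 := by
    rintro rfl
    obtain ⟨y, hy⟩ : U.Nonempty := Finset.card_pos.mp (hU ▸ hk)
    have h1 := hvc y (hUR hy)
    have h2 := hvc x₀ hx₀R
    simp [hy] at h1
    simp [hx₀U] at h2
    omega
  have hvpos := L.pos v hvne
  simp only [map_smul, LinearMap.smul_apply, smul_eq_mul] at hnorm
  have hupos : 0 < L.form u u := by
    apply L.pos
    rintro hu0
    rw [hu0] at hnorm
    simp at hnorm
    have : (k : ℤ) ≤ k ^ 2 := by nlinarith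
    linarith
  have : L.form u u ≤ 1 := by
    by_contra hgt
    have h2 : 2 ≤ L.form u u := by omega
    have h3 : (k : ℤ) * (k * 2) ≤ k * (k * L.form u u) := by gcongr
    have : (0 : ℤ) < k * k := mul_pos hkZ hkZ
    linarith
  exact hL u (by omega)

/-- A short glue vector of a face of a simplex is a glue vector of the whole simplex. -/
theorem IsGlue.extend {P : Finset L.carrier} (hR : IsSimplex R) (hPR : P ⊆ R) {k : ℕ} (hk : 2 ≤ k)
    (h1 : 2 * k ^ 2 < P.card) (h2 : (k + 1) ^ 2 < P.card) {v : L.carrier} (hv : IsGlue P k v) :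
    IsGlue R k v := by
  classical
  obtain ⟨hvk, c, U, hUP, hU, hvc⟩ := hv
  refine ⟨hvk, c, U, hUP.trans hPR, hU, ?_⟩
  set z : L.carrier → ℤ := fun x => L.form v x - c with hz
  have hzP : ∀ x ∈ P, z x = if x ∈ U then 1 else 0 := fun x hx => by simp [hz, hvc x hx]
  have hpat : ∀ x ∈ R, L.form v x = c + z x := fun x _ => by simp [hz]
  set N : ℤ := (R.card : ℤ) with hN
  set n : ℤ := (P.card : ℤ) with hn
  set q := ∑ x ∈ R \ P, z x ^ 2 with hq
  set K := ∑ x ∈ R \ P, z x with hK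
  have hq0 : 0 ≤ q := Finset.sum_nonneg fun _ _ => sq_nonneg _
  have hKq : K ≤ q := Finset.sum_le_sum fun x _ => by nlinarith [Int.le_self_sq (z x)]
  have sP : ∑ x ∈ P, z x = k := by
    rw [Finset.sum_congr rfl hzP, sum_indicator_of_subset hUP, hU]
  have sP2 : ∑ x ∈ P, z x ^ 2 = k := by
    rw [← sP]
    exact Finset.sum_congr rfl fun x hx => by rw [hzP x hx]; split_ifs <;> norm_num
  have sR : ∑ x ∈ R, z x = k + K := by rw [← Finset.sum_sdiff hPR, sP]; ring
  have sR2 : ∑ x ∈ R, z x ^ 2 = k + q := by rw [← Finset.sum_sdiff hPR, sP2]; ring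
  have hb := hR.bessel v hpat
  rw [sR, sR2, ← hN] at hb
  set S : ℤ := k + K with hS
  have hn1 : 2 * (k : ℤ) ^ 2 < n := by rw [hn]; exact_mod_cast h1
  have hn2 : ((k : ℤ) + 1) ^ 2 < n := by rw [hn]; exact_mod_cast h2
  have hnN : n ≤ N := by rw [hn, hN]; exact_mod_cast Finset.card_le_card hPR
  have hk2 : (2 : ℤ) ≤ k := by exact_mod_cast hk
  have hnpos : 0 < n := by nlinarith
  have hNpos : 0 < N := by linarith
  have hb1 : N * q ≤ S ^ 2 := by nlinarith
  -- The deviations of `z` from its mean, scaled by `N`, have square sum at most `N ^ 2 * k` over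
  -- `R` by Bessel. Keeping only the terms over `P`, where `z` is known, bounds the mean.
  have hb2 : n * S ^ 2 ≤ 2 * N * S * k := by
    have e1 : ∑ x ∈ R, (N * z x - S) ^ 2 = N * (N * (k + q) - S ^ 2) := by
      have : ∀ x ∈ R, (N * z x - S) ^ 2 = N ^ 2 * z x ^ 2 - 2 * N * S * z x + S ^ 2 :=
        fun x _ => by ring
      rw [Finset.sum_congr rfl this, Finset.sum_add_distrib, Finset.sum_sub_distrib,
        ← Finset.mul_sum, ← Finset.mul_sum, sR, sR2, Finset.sum_const, nsmul_eq_mul, ← hN]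
      ring
    have e2 : ∑ x ∈ P, (N * z x - S) ^ 2 = N ^ 2 * k - 2 * N * S * k + n * S ^ 2 := by
      have : ∀ x ∈ P, (N * z x - S) ^ 2 = N ^ 2 * z x ^ 2 - 2 * N * S * z x + S ^ 2 :=
        fun x _ => by ring
      rw [Finset.sum_congr rfl this, Finset.sum_add_distrib, Finset.sum_sub_distrib,
        ← Finset.mul_sum, ← Finset.mul_sum, sP, sP2, Finset.sum_const, nsmul_eq_mul, ← hn]
    have e3 : ∑ x ∈ P, (N * z x - S) ^ 2 ≤ ∑ x ∈ R, (N * z x - S) ^ 2 :=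
      Finset.sum_le_sum_of_subset_of_nonneg hPR fun _ _ _ => sq_nonneg _
    rw [e1, e2] at e3
    have e4 : N * (N * (k + q) - S ^ 2) ≤ N * (N * k) :=
      mul_le_mul_of_nonneg_left (hb.trans (mul_le_mul_of_nonneg_left hvk hNpos.le)) hNpos.le
    linarith
  have hSpos : 0 < S := by
    by_contra hS0
    have hS0 : S ≤ 0 := not_lt.mp hS0
    have : 2 * N * S * k ≤ 0 := by
      have : 0 ≤ 2 * N * (-S) * k := by
        apply mul_nonneg (mul_nonneg (by linarith) (by linarith)) (by linarith)
      linarith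
    have h3 : S ^ 2 ≤ 0 := by
      by_contra h; push Not at h
      have := mul_pos hnpos h
      linarith
    have h4 : q = 0 := by
      have : N * q ≤ 0 := hb1.trans h3
      by_contra hq'
      have := mul_pos hNpos (lt_of_le_of_ne hq0 (Ne.symm hq'))
      linarith
    have h5 : K = 0 := by
      have hall := (Finset.sum_eq_zero_iff_of_nonneg (fun x _ => sq_nonneg (z x))).mp h4
      exact Finset.sum_eq_zero fun x hx => by simpa using hall x hx
    rw [h5] at hS
    linarith
  have hb3 : n * S ≤ 2 * N * k := by
    refine le_of_mul_le_mul_right ?_ hSpos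
    linarith
  have hb4 : k * S < N := by
    by_contra h; push Not at h
    have e1 : n * N ≤ n * (k * S) := mul_le_mul_of_nonneg_left h hnpos.le
    have e2 : (k : ℤ) * (n * S) ≤ k * (2 * N * k) := mul_le_mul_of_nonneg_left hb3 (by linarith)
    have e3 : 2 * (k : ℤ) ^ 2 * N < n * N := mul_lt_mul_of_pos_right hn1 hNpos
    linarith
  -- Since S = k + K ≤ k + q, this yields q(k - 1) < k, so q ≤ 1 because k ≥ 2. The value q = 1 is
  -- then excluded by (k + 1)² < n ≤ N.
  have hb5 : q * k < S := by
    refine lt_of_mul_lt_mul_left ?_ hNpos.le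
    have e1 : k * (N * q) ≤ k * S ^ 2 := mul_le_mul_of_nonneg_left hb1 (by linarith)
    have e2 : k * S * S < N * S := mul_lt_mul_of_pos_right hb4 hSpos
    linarith
  have hq1 : q ≤ 1 := by nlinarith
  have hqz : q = 0 := by
    by_contra hne
    have hq' : q = 1 := by omega
    have : S ≤ k + 1 := by linarith
    have : S ^ 2 ≤ (k + 1) ^ 2 := by gcongr
    rw [hq'] at hb1
    linarith
  intro x hx
  rw [hpat x hx]
  congr 1
  by_cases hxP : x ∈ P
  · exact hzP x hxP
  · have hall := (Finset.sum_eq_zero_iff_of_nonneg (fun x _ => sq_nonneg (z x))).mp hqz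
    have := hall x (Finset.mem_sdiff.mpr ⟨hx, hxP⟩)
    rw [if_neg fun h => hxP (hUP h)]
    simpa using this

/-! ### Maximal simplices and roots -/

theorem form_sq_le (x y : L.carrier) : L.form x y ^ 2 ≤ L.form x x * L.form y y := by
  by_cases hy : y = 0
  · simp [hy]
  have hpos := L.pos y hy
  have h := form_self_nonneg (L.form y y • x - L.form x y • y)
  rw [form_sub_self] at h
  simp only [map_smul, LinearMap.smul_apply, smul_eq_mul] at h
  have : 0 ≤ L.form y y * (L.form x x * L.form y y - L.form x y ^ 2) := by linarith
  have := nonneg_of_mul_nonneg_right this hpos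
  linarith

open Classical in
theorem exists_indicator {v : L.carrier}
    (h : ∀ x ∈ R, ∀ y ∈ R, L.form v x - L.form v y ≤ 1) :
    ∃ c : ℤ, ∃ U ⊆ R, ∀ x ∈ R, L.form v x = c + if x ∈ U then 1 else 0 := by
  rcases R.eq_empty_or_nonempty with rfl | hne
  · exact ⟨0, ∅, by simp, by simp⟩
  obtain ⟨x₀, hx₀, hmin⟩ := R.exists_min_image (fun x => L.form v x) hne
  refine ⟨L.form v x₀, R.filter fun x => L.form v x ≠ L.form v x₀, Finset.filter_subset _ _, ?_⟩
  intro x hx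
  have h1 := h x hx x₀ hx₀
  have h2 := hmin x hx
  by_cases heq : L.form v x = L.form v x₀
  · simp [heq]
  · simp only [Finset.mem_filter, hx, true_and, ne_eq, heq, not_false_eq_true, if_true]
    omega

open Classical in
theorem IsSimplex.card_mul_card_sub_le (hR : IsSimplex R) {v : L.carrier} {c : ℤ}
    {U : Finset L.carrier} (hU : U ⊆ R)
    (hv : ∀ x ∈ R, L.form v x = c + if x ∈ U then 1 else 0) :
    (U.card : ℤ) * (R.card - U.card) ≤ R.card * L.form v v := by
  have h := hR.bessel v hv
  have : ∀ x ∈ R, (if x ∈ U then (1 : ℤ) else 0) ^ 2 = if x ∈ U then 1 else 0 :=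
    fun x _ => by split_ifs <;> norm_num
  rw [Finset.sum_congr rfl this, sum_indicator_of_subset hU] at h
  linarith

-- Passing to the negative replaces the distinguished set of vertices by its complement, so only
-- small sets need to be treated.
open Classical in
theorem indicator_neg {v : L.carrier} {c : ℤ} {U : Finset L.carrier}
    (hv : ∀ x ∈ R, L.form v x = c + if x ∈ U then 1 else 0) :
    ∀ x ∈ R, L.form (-v) x = (-c - 1) + if x ∈ R \ U then 1 else 0 := fun x hx => by
  rw [map_neg, LinearMap.neg_apply, hv x hx]
  by_cases h : x ∈ U <;> (simp [h, hx]; try ring)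

open Classical in
/-- A simplex that is maximal under inclusion. -/
def IsMaxSimplex (R : Finset L.carrier) : Prop :=
  IsSimplex R ∧ ∀ y, IsSimplex (insert y R) → y ∈ R

open Classical in
theorem IsSimplex.insert_vertex {y : L.carrier} (hR : IsSimplex R)
    (hy : ∀ x ∈ R, L.form (y - x) (y - x) = 2) : IsSimplex (insert y R) := by
  intro a ha b hb hab
  rw [Finset.mem_insert] at ha hb
  rcases ha with rfl | ha <;> rcases hb with rfl | hb
  · exact absurd rfl hab
  · exact hy b hb
  · have := hy a ha
    rw [← neg_sub, map_neg, map_neg, LinearMap.neg_apply, neg_neg]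
    exact this
  · exact hR a ha b hb hab

/-- The edges at one vertex are independent, since a combination with coefficient sum 0 has norm the
sum of the squares. This bound is what makes maximal simplices exist. -/
theorem IsSimplex.card_le (hR : IsSimplex R) : R.card ≤ L.rank + 1 := by
  classical
  rcases R.eq_empty_or_nonempty with rfl | ⟨x₀, hx₀⟩
  · simp
  have hli : LinearIndependent ℤ (fun x : (R.erase x₀ : Finset L.carrier) => (x : L.carrier) - x₀) := by
    rw [Fintype.linearIndependent_iff]
    intro g hg
    set c : L.carrier → ℤ := fun x => if h : x ∈ R.erase x₀ then g ⟨x, h⟩ else 0 with hc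
    have hgc : ∑ x ∈ R.erase x₀, c x • (x - x₀) = 0 := by
      rw [← hg, ← Finset.sum_coe_sort]
      exact Finset.sum_congr rfl fun x _ => by
        simp only [hc]
        rw [dif_pos x.2]
    set S := ∑ x ∈ R.erase x₀, c x with hS
    set c' : L.carrier → ℤ := fun x => if x = x₀ then -S else c x with hc'
    have hne : ∀ x ∈ R.erase x₀, c' x = c x := fun x hx => by
      simp [hc', Finset.ne_of_mem_erase hx]
    have hsum : ∑ x ∈ R, c' x = 0 := by
      rw [← Finset.add_sum_erase R _ hx₀, Finset.sum_congr rfl hne]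
      simp [hc', hS]
    have hcomb : ∑ x ∈ R, c' x • x = 0 := by
      rw [← Finset.add_sum_erase R _ hx₀,
        Finset.sum_congr rfl fun x hx => by rw [hne x hx]]
      rw [← hgc]
      simp only [smul_sub, Finset.sum_sub_distrib, ← Finset.sum_smul, ← hS]
      simp [hc']
      abel
    have hsq := hR.form_combination_self hsum
    rw [hcomb] at hsq
    simp only [map_zero] at hsq
    have hall := (Finset.sum_eq_zero_iff_of_nonneg (fun x _ => sq_nonneg (c' x))).mp hsq.symm
    intro i
    have := hall i (Finset.mem_of_mem_erase i.2)
    rw [hne i i.2] at this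
    simp only [hc, i.2, dif_pos] at this
    simpa using this
  have h := hli.fintype_card_le_finrank
  rw [Fintype.card_coe, Finset.card_erase_of_mem hx₀] at h
  unfold rank
  omega

theorem IsSimplex.exists_isMaxSimplex {P : Finset L.carrier} (hP : IsSimplex P) :
    ∃ R, P ⊆ R ∧ IsMaxSimplex R := by
  classical
  induction hn : L.rank + 1 - P.card using Nat.strong_induction_on generalizing P with
  | _ n ih =>
    by_cases hmax : IsMaxSimplex P
    · exact ⟨P, subset_rfl, hmax⟩
    · simp only [IsMaxSimplex, hP, true_and, not_forall] at hmax
      obtain ⟨y, hy, hyP⟩ := hmax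
      have hcard := hy.card_le
      rw [Finset.card_insert_of_notMem hyP] at hcard
      obtain ⟨R, hPR, hR⟩ := ih (L.rank + 1 - (insert y P).card)
        (by rw [Finset.card_insert_of_notMem hyP]; omega) hy rfl
      exact ⟨R, (Finset.subset_insert _ _).trans hPR, hR⟩

/-- According to the size of `U`: for 0 the root is orthogonal to all edges; for 1, reflecting
through the single vertex `x₀` gives a point `x₀ - b` at the right distance from all of `R`, which
maximality puts in `R`; for 2, `b` is glue of index 2, incompatible with glue of odd index `p`. -/
theorem IsMaxSimplex.root_aux (hL : ∀ x : L.carrier, L.form x x ≠ 1) (hR : IsMaxSimplex R)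
    {p : ℕ} {v : L.carrier} (hp : Odd p) (hv : IsGlue R p v) (hcard : 2 * (2 * p) < R.card)
    {b : L.carrier} (hb : L.form b b = 2) {c : ℤ} {U : Finset L.carrier} (hUR : U ⊆ R)
    (hU : U.card ≤ 2) (hbc : by classical exact ∀ x ∈ R, L.form b x = c + if x ∈ U then 1 else 0) :
    (∀ x ∈ R, ∀ y ∈ R, L.form b (x - y) = 0) ∨ ∃ x ∈ R, ∃ y ∈ R, b = x - y := by
  classical
  rcases (by omega : U.card = 0 ∨ U.card = 1 ∨ U.card = 2) with h0 | h1 | h2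
  · left
    rw [Finset.card_eq_zero] at h0
    subst h0
    intro x hx y hy
    rw [map_sub, hbc x hx, hbc y hy]
    simp
  · right
    obtain ⟨x₀, rfl⟩ := Finset.card_eq_one.mp h1
    have hx₀ : x₀ ∈ R := hUR (by simp)
    have hmem : x₀ - b ∈ R := by
      apply hR.2
      apply hR.1.insert_vertex
      intro x hx
      rw [show x₀ - b - x = (x₀ - x) - b by abel, form_sub_self, L.symm (x₀ - x) b, map_sub (L.form b),
        hbc x₀ hx₀, hbc x hx, hb]
      by_cases h : x = x₀
      · subst h; simp
      · rw [hR.1 x₀ hx₀ x hx (Ne.symm h)]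
        simp [h]
    exact ⟨x₀, hx₀, x₀ - b, hmem, by abel⟩
  · exfalso
    have hg : IsGlue R 2 b := ⟨by simp [hb], c, U, hUR, h2, by convert hbc⟩
    exact not_isGlue_of_coprime hL hR.1 two_pos hp.pos (Nat.coprime_two_left.mpr hp) hcard hg hv

/-- A vector of norm two is orthogonal to a maximal simplex, or one of its edges. -/
theorem IsMaxSimplex.root (hL : ∀ x : L.carrier, L.form x x ≠ 1) (hR : IsMaxSimplex R)
    {p : ℕ} {v : L.carrier} (hp : Odd p) (hv : IsGlue R p v) (hcard : 2 * (2 * p) < R.card)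
    (h10 : 10 ≤ R.card) {b : L.carrier} (hb : L.form b b = 2) :
    (∀ x ∈ R, ∀ y ∈ R, L.form b (x - y) = 0) ∨ ∃ x ∈ R, ∃ y ∈ R, b = x - y := by
  classical
  by_cases hbig : ∃ x ∈ R, ∃ y ∈ R, 2 ≤ L.form b x - L.form b y
  · right
    obtain ⟨x, hx, y, hy, h⟩ := hbig
    have hne : x ≠ y := by rintro rfl; simp at h
    refine ⟨x, hx, y, hy, ?_⟩
    rw [← sub_eq_zero]
    apply eq_zero_of_form_self_nonpos
    rw [form_sub_self, hb, hR.1 x hx y hy hne, map_sub]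
    linarith
  · push Not at hbig
    obtain ⟨c, U, hUR, hbc⟩ := exists_indicator (R := R) (v := b)
      fun x hx y hy => by have := hbig x hx y hy; omega
    have hle := hR.1.card_mul_card_sub_le hUR hbc
    rw [hb] at hle
    have hcl := Finset.card_le_card hUR
    have h10' : (10 : ℤ) ≤ R.card := by exact_mod_cast h10
    have hcl' : (U.card : ℤ) ≤ R.card := by exact_mod_cast hcl
    -- If both sizes were at least 3, their product would be at least 3(N - 3), which exceeds 2N
    -- once N ≥ 10.
    have : U.card ≤ 2 ∨ R.card - U.card ≤ 2 := by
      by_contra! hcon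
      have h1 : (3 : ℤ) ≤ U.card := by exact_mod_cast hcon.1
      have h2 : (3 : ℤ) ≤ R.card - U.card := by have := hcon.2; omega
      nlinarith
    rcases this with h | h
    · exact hR.root_aux hL hp hv hcard hb hUR h hbc
    · rcases hR.root_aux hL hp hv hcard (b := -b) (by simpa using hb) Finset.sdiff_subset
        (by rwa [Finset.card_sdiff_of_subset hUR]) (indicator_neg hbc) with h | ⟨x, hx, y, hy, h⟩
      · left
        intro x hx y hy
        simpa using h y hy x hx
      · exact .inr ⟨y, hy, x, hx, by rw [← neg_neg b, h]; abel⟩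

/-! ### Orthogonality of simplices with coprime glue -/

open Classical in
theorem IsGlue.translate {P : Finset L.carrier} {k : ℕ} {v : L.carrier} (hv : IsGlue P k v)
    (t : L.carrier) : IsGlue (P.image fun x => x + t) k v := by
  obtain ⟨hk, c, U, hUP, hU, hvc⟩ := hv
  refine ⟨hk, c + L.form v t, U.image fun x => x + t, Finset.image_subset_image hUP, ?_, ?_⟩
  · rw [Finset.card_image_of_injective _ (add_left_injective t), hU]
  · intro y hy
    obtain ⟨x, hx, rfl⟩ := Finset.mem_image.mp hy
    simp only [map_add, hvc x hx, Finset.mem_image, add_left_inj, exists_eq_right]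
    ring

open Classical in
theorem IsGlue.reflect {P : Finset L.carrier} {k : ℕ} {v : L.carrier} (hv : IsGlue P k v)
    (t : L.carrier) : IsGlue (P.image fun x => t - x) k (-v) := by
  obtain ⟨hk, c, U, hUP, hU, hvc⟩ := hv
  refine ⟨by simpa using hk, c - L.form v t, U.image fun x => t - x,
    Finset.image_subset_image hUP, ?_, ?_⟩
  · rw [Finset.card_image_of_injective _ sub_right_injective, hU]
  · intro y hy
    obtain ⟨x, hx, rfl⟩ := Finset.mem_image.mp hy
    simp only [map_sub, map_neg, LinearMap.neg_apply, hvc x hx, Finset.mem_image, sub_right_inj,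
      exists_eq_right]
    ring

/-- A simplex whose edges are edges of `R` is, up to translation and reflection, a face of `R`. -/
theorem IsSimplex.exists_translate (hR : IsSimplex R) {P : Finset L.carrier} (hP : IsSimplex P)
    (hcard : 3 ≤ P.card) (h : ∀ x ∈ P, ∀ y ∈ P, ∃ f ∈ R, ∃ g ∈ R, x - y = f - g) :
    (∃ t, ∀ x ∈ P, x + t ∈ R) ∨ ∃ t, ∀ x ∈ P, t - x ∈ R := by
  classical
  obtain ⟨x₀, h0, x₁, h1, x₂, h2, h01, h02, h12⟩ := Finset.two_lt_card.mp hcard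
  -- Two edges at `x₀` have inner product 1, so as edges of `R` they share exactly one of head and
  -- tail.
  have key : ∀ x ∈ P, ∀ y ∈ P, x ≠ x₀ → y ≠ x₀ → x ≠ y → ∀ f ∈ R, ∀ g ∈ R, ∀ f' ∈ R, ∀ g' ∈ R,
      x - x₀ = f - g → y - x₀ = f' - g' → (f = f' ∧ g ≠ g') ∨ (f ≠ f' ∧ g = g') := by
    intro x hx y hy hx0 hy0 hxy f hf g hg f' hf' g' hg' e e'
    have h1 := hP.form_sub_sub hx h0 hy h0
    rw [if_neg hxy, if_neg hx0, if_neg (Ne.symm hy0), if_pos rfl, e, e',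
      hR.form_sub_sub hf hg hf' hg'] at h1
    have hfg : f ≠ g := by rintro rfl; exact hx0 (by simpa [sub_eq_zero] using e)
    have hfg' : f' ≠ g' := by rintro rfl; exact hy0 (by simpa [sub_eq_zero] using e')
    by_cases a : f = f' <;> by_cases b : g = g'
    · subst a b; simp [hfg, hfg.symm] at h1
    · exact .inl ⟨a, b⟩
    · exact .inr ⟨a, b⟩
    · rw [if_neg a, if_neg b] at h1
      split_ifs at h1 <;> omega
  obtain ⟨f₁, hf₁, g₁, hg₁, e₁⟩ := h x₁ h1 x₀ h0
  obtain ⟨f₂, hf₂, g₂, hg₂, e₂⟩ := h x₂ h2 x₀ h0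
  -- A common head gives a reflection into `R`, a common tail a translation. The third edge of a
  -- triangle test forces every further edge to share the same end.
  rcases key x₁ h1 x₂ h2 h01.symm h02.symm h12 f₁ hf₁ g₁ hg₁ f₂ hf₂ g₂ hg₂ e₁ e₂ with
    ⟨rfl, hg⟩ | ⟨hf, rfl⟩
  · right
    refine ⟨x₀ + f₁, fun x hx => ?_⟩
    by_cases hx0 : x = x₀
    · subst hx0; simpa using hf₁
    by_cases hx1 : x = x₁
    · subst hx1
      rw [show x₀ + f₁ - x = f₁ - (x - x₀) by abel, e₁]; simpa using hg₁
    by_cases hx2 : x = x₂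
    · subst hx2
      rw [show x₀ + f₁ - x = f₁ - (x - x₀) by abel, e₂]; simpa using hg₂
    obtain ⟨f, hf, g, hg', e⟩ := h x hx x₀ h0
    have k1 := key x hx x₁ h1 hx0 h01.symm hx1 f hf g hg' f₁ hf₁ g₁ hg₁ e e₁
    have k2 := key x hx x₂ h2 hx0 h02.symm hx2 f hf g hg' f₁ hf₂ g₂ hg₂ e e₂
    have : f = f₁ := by
      by_contra hne
      rcases k1 with k1 | k1
      · exact hne k1.1
      rcases k2 with k2 | k2
      · exact hne k2.1
      exact hg (k1.2.symm.trans k2.2)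
    subst this
    rw [show x₀ + f - x = f - (x - x₀) by abel, e]; simpa using hg'
  · left
    refine ⟨g₁ - x₀, fun x hx => ?_⟩
    rw [show x + (g₁ - x₀) = g₁ + (x - x₀) by abel]
    by_cases hx0 : x = x₀
    · subst hx0; simpa using hg₁
    by_cases hx1 : x = x₁
    · subst hx1
      rw [e₁]; simpa using hf₁
    by_cases hx2 : x = x₂
    · subst hx2
      rw [e₂]; simpa using hf₂
    obtain ⟨f, hf', g, hg', e⟩ := h x hx x₀ h0
    have k1 := key x hx x₁ h1 hx0 h01.symm hx1 f hf' g hg' f₁ hf₁ g₁ hg₁ e e₁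
    have k2 := key x hx x₂ h2 hx0 h02.symm hx2 f hf' g hg' f₂ hf₂ g₁ hg₂ e e₂
    have : g = g₁ := by
      by_contra hne
      rcases k1 with k1 | k1
      · rcases k2 with k2 | k2
        · exact hf (k1.1.symm.trans k2.1)
        · exact hne k2.2
      · exact hne k1.2
    subst this
    rw [e]; simpa using hf'

/-- Two simplices with short glue vectors of different prime indices are orthogonal. -/
theorem IsSimplex.orthogonal (hL : ∀ x : L.carrier, L.form x x ≠ 1) {P P' : Finset L.carrier}
    (hP : IsSimplex P) (hP' : IsSimplex P') {p q : ℕ} (hp : Odd p) (hp3 : 3 ≤ p) (hq : 2 ≤ q)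
    (hpq : p.Coprime q) (hp2 : 2 * p ^ 2 < P.card) (hq2 : 2 * q ^ 2 < P.card)
    (hcard : P'.card = P.card) {v w : L.carrier} (hv : IsGlue P p v) (hw : IsGlue P' q w)
    {x y x' y' : L.carrier} (hx : x ∈ P) (hy : y ∈ P) (hx' : x' ∈ P') (hy' : y' ∈ P') :
    L.form (x' - y') (x - y) = 0 := by
  classical
  have hP18 : 18 < P.card := by nlinarith
  have hp1 : (p + 1) ^ 2 < P.card := by nlinarith
  have hq1 : (q + 1) ^ 2 < P.card := by
    rcases (by omega : q = 2 ∨ 3 ≤ q) with rfl | h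
    · omega
    · nlinarith
  -- From 2pq ≤ p² + q².
  have hpq2 : 2 * (p * q) < P.card := by nlinarith [sq_nonneg ((p : ℤ) - q), two_mul_le_add_sq p q]
  have hp4 : 2 * (2 * p) < P.card := by nlinarith
  obtain ⟨R, hPR, hR⟩ := hP.exists_isMaxSimplex
  have hPRc := Finset.card_le_card hPR
  have hvR : IsGlue R p v := hv.extend hR.1 hPR (by omega) hp2 hp1
  have hroot : ∀ a ∈ P', ∀ b ∈ P', a ≠ b →
      (∀ x ∈ R, ∀ y ∈ R, L.form (a - b) (x - y) = 0) ∨ ∃ x ∈ R, ∃ y ∈ R, a - b = x - y :=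
    fun a ha b hb hab => hR.root hL hp hvR (by omega) (by omega) (hP' a ha b hb hab)
  -- Adjacent edges of `P'` have inner product 1, so being an edge of `R` spreads from one edge to
  -- all of them.
  have hconn : ∀ a ∈ P', ∀ b ∈ P', ∀ c ∈ P', a ≠ b → a ≠ c → b ≠ c →
      (∃ x ∈ R, ∃ y ∈ R, a - b = x - y) → ∃ x ∈ R, ∃ y ∈ R, a - c = x - y := by
    rintro a ha b hb c hc hab hac hbc ⟨f, hf, g, hg, e⟩
    refine (hroot a ha c hc hac).resolve_left fun h => ?_
    have h1 := hP'.form_sub_sub_of_ne ha hc hb hac hab hbc.symm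
    rw [e, h f hf g hg] at h1
    exact zero_ne_one h1
  by_cases hxy' : x' = y'
  · simp [hxy']
  refine (hroot x' hx' y' hy' hxy').elim (fun h => h x (hPR hx) y (hPR hy)) fun hedge => ?_
  exfalso
  have hswap : ∀ a b, (∃ x ∈ R, ∃ y ∈ R, a - b = x - y) → ∃ x ∈ R, ∃ y ∈ R, b - a = x - y := by
    rintro a b ⟨f, hf, g, hg, e⟩
    exact ⟨g, hg, f, hf, by rw [← neg_sub a b, e, neg_sub]⟩
  have hfrom : ∀ a ∈ P', a ≠ x' → ∃ f ∈ R, ∃ g ∈ R, x' - a = f - g := fun a ha hax => by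
    by_cases hay : a = y'
    · exact hay ▸ hedge
    · exact hconn x' hx' y' hy' a ha hxy' (Ne.symm hax) (Ne.symm hay) hedge
  have hall : ∀ a ∈ P', ∀ b ∈ P', ∃ f ∈ R, ∃ g ∈ R, a - b = f - g := fun a ha b hb => by
    by_cases hab : a = b
    · exact ⟨x, hPR hx, x, hPR hx, by simp [hab]⟩
    by_cases hax : a = x'
    · exact hax ▸ hfrom b hb (fun h => hab (hax.trans h.symm))
    by_cases hbx : b = x'
    · exact hbx ▸ hswap _ _ (hfrom a ha hax)
    · exact hconn a ha x' hx' b hb hax hab (Ne.symm hbx) (hswap _ _ (hfrom a ha hax))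
  rcases hR.1.exists_translate hP' (by omega) hall with ⟨t, ht⟩ | ⟨t, ht⟩
  · have hsub : P'.image (fun x => x + t) ⊆ R := by
      intro y hy
      obtain ⟨x, hx, rfl⟩ := Finset.mem_image.mp hy
      exact ht x hx
    have hc : (P'.image (fun x => x + t)).card = P.card := by
      rw [Finset.card_image_of_injective _ (add_left_injective t), hcard]
    exact not_isGlue_of_coprime hL hR.1 (by omega) (by omega) hpq (by omega) hvR
      ((hw.translate t).extend hR.1 hsub hq (by omega) (by omega))
  · have hsub : P'.image (fun x => t - x) ⊆ R := by
      intro y hy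
      obtain ⟨x, hx, rfl⟩ := Finset.mem_image.mp hy
      exact ht x hx
    have hc : (P'.image (fun x => t - x)).card = P.card := by
      rw [Finset.card_image_of_injective _ sub_right_injective, hcard]
    exact not_isGlue_of_coprime hL hR.1 (by omega) (by omega) hpq (by omega) hvR
      ((hw.reflect t).extend hR.1 hsub hq (by omega) (by omega))

/-! ### Splitting off an orthonormal family -/

variable {m : ℕ}

theorem form_map {M : PosDefLattice} {σ : M.carrier →ₗ[ℤ] L.carrier}
    (hσ : ∀ x, L.form (σ x) (σ x) = M.form x x) (x y : M.carrier) :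
    L.form (σ x) (σ y) = M.form x y := by
  have h := hσ (x + y)
  rw [map_add, form_add_self, form_add_self, hσ, hσ] at h
  linarith

/-- A family of vectors spanning a copy of a cubic lattice. -/
def IsOrthonormal {ι : Type*} [DecidableEq ι] (f : ι → L.carrier) : Prop :=
  ∀ i j, L.form (f i) (f j) = if i = j then 1 else 0

theorem IsOrthonormal.form_sum {ι : Type*} [DecidableEq ι] [Fintype ι] {f : ι → L.carrier}
    (hf : IsOrthonormal f) (a : ι → ℤ) (j : ι) : L.form (∑ i, a i • f i) (f j) = a j := by
  simp [map_sum, LinearMap.sum_apply, hf _ j]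

theorem IsOrthonormal.form_sum_self {ι : Type*} [DecidableEq ι] [Fintype ι] {f : ι → L.carrier}
    (hf : IsOrthonormal f) (a : ι → ℤ) :
    L.form (∑ i, a i • f i) (∑ i, a i • f i) = ∑ i, a i * a i := by
  rw [map_sum]
  exact Finset.sum_congr rfl fun i _ => by rw [map_smul, hf.form_sum, smul_eq_mul]

theorem IsOrthonormal.represents {n : ℕ} {f : Fin n → L.carrier} (hf : IsOrthonormal f) :
    L.Represents (cubic n) := by
  refine ⟨Fintype.linearCombination ℤ f, fun x => ?_⟩
  simp only [Fintype.linearCombination_apply]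
  exact hf.form_sum_self x

/-- The orthogonal complement of a family of vectors. -/
def orth (f : Fin m → L.carrier) : Submodule ℤ L.carrier := ⨅ i, LinearMap.ker (L.form (f i))

theorem mem_orth {f : Fin m → L.carrier} {x : L.carrier} : x ∈ orth f ↔ ∀ i, L.form (f i) x = 0 := by
  simp [orth]

/-- The projection to the orthogonal complement of an orthonormal family. -/
noncomputable def proj (f : Fin m → L.carrier) : L.carrier →ₗ[ℤ] L.carrier :=
  LinearMap.id - ∑ i, (L.form (f i)).smulRight (f i)

theorem proj_apply (f : Fin m → L.carrier) (x : L.carrier) :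
    proj f x = x - ∑ i, L.form (f i) x • f i := by
  simp [proj]

variable {f : Fin m → L.carrier}

theorem IsOrthonormal.proj_mem (hf : IsOrthonormal f) (x : L.carrier) : proj f x ∈ orth f := by
  rw [mem_orth]
  intro j
  rw [proj_apply, map_sub, L.symm (f j) (∑ i, _), hf.form_sum, sub_self]

theorem form_proj_left (x : L.carrier) {y : L.carrier} (hy : y ∈ orth f) :
    L.form (proj f x) y = L.form x y := by
  rw [mem_orth] at hy
  simp [proj_apply, map_sub, map_sum, LinearMap.sub_apply, LinearMap.sum_apply, hy]

theorem IsOrthonormal.form_self_eq (hf : IsOrthonormal f) (x : L.carrier) :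
    L.form x x = L.form (proj f x) (proj f x) + ∑ i, L.form (f i) x ^ 2 := by
  have h : L.form (proj f x) (proj f x) = L.form x (proj f x) := form_proj_left _ (hf.proj_mem x)
  rw [h, proj_apply, map_sub, map_sum]
  simp only [map_smul, smul_eq_mul, L.symm x (f _), ← sq]
  ring

/-- Such a vector would extend `f` to an orthonormal family of `m + 1` vectors. -/
theorem IsOrthonormal.form_self_ne_one (hf : IsOrthonormal f)
    (hno : ¬ L.Represents (cubic (m + 1))) {x : L.carrier} (hx : x ∈ orth f) :
    L.form x x ≠ 1 := by
  intro h1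
  rw [mem_orth] at hx
  refine hno (IsOrthonormal.represents (f := Fin.cons x f) fun i j => ?_)
  refine Fin.cases ?_ (fun i => ?_) i <;> refine Fin.cases ?_ (fun j => ?_) j
  · simp [h1]
  · simp [L.symm x, hx, (Fin.succ_ne_zero j).symm]
  · simp [hx]
  · simp [hf i j]

/-- The norm 2 splits as a projected norm plus a sum of integer squares, and the projected norm
cannot be 1. -/
theorem IsOrthonormal.root (hf : IsOrthonormal f) (hno : ¬ L.Represents (cubic (m + 1)))
    {b : L.carrier} (hb : L.form b b = 2) : b ∈ orth f ∨ proj f b = 0 := by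
  have h := hf.form_self_eq b
  rw [hb] at h
  have h1 := hf.form_self_ne_one hno (hf.proj_mem b)
  have h0 := form_self_nonneg (proj f b)
  have hs : 0 ≤ ∑ i, L.form (f i) b ^ 2 := Finset.sum_nonneg fun _ _ => sq_nonneg _
  by_cases hz : ∑ i, L.form (f i) b ^ 2 = 0
  · left
    rw [mem_orth]
    intro i
    have := (Finset.sum_eq_zero_iff_of_nonneg fun i _ => sq_nonneg (L.form (f i) b)).mp hz i
      (Finset.mem_univ i)
    simpa using this
  · right
    exact eq_zero_of_form_self_nonpos (by omega)

theorem IsOrthonormal.root_of_root (hf : IsOrthonormal f) (hno : ¬ L.Represents (cubic (m + 1)))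
    {b b' : L.carrier} (hb' : L.form b' b' = 2) (hbb : L.form b b' ≠ 0) (h : proj f b = 0) :
    proj f b' = 0 := by
  refine (hf.root hno hb').resolve_left fun hmem => hbb ?_
  rw [← form_proj_left b hmem, h]
  simp

theorem sum_sum_sub_sq {α : Type*} (R : Finset α) (z : α → ℤ) :
    ∑ x ∈ R, ∑ y ∈ R, (z x - z y) ^ 2
      = 2 * (R.card * ∑ x ∈ R, z x ^ 2 - (∑ x ∈ R, z x) ^ 2) := by
  have h : ∀ x ∈ R, ∑ y ∈ R, (z x - z y) ^ 2
      = R.card * z x ^ 2 - 2 * (∑ y ∈ R, z y) * z x + ∑ y ∈ R, z y ^ 2 := fun x _ => by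
    have : ∀ y ∈ R, (z x - z y) ^ 2 = z x ^ 2 - 2 * z x * z y + z y ^ 2 := fun y _ => by ring
    rw [Finset.sum_congr rfl this, Finset.sum_add_distrib, Finset.sum_sub_distrib,
      ← Finset.mul_sum, Finset.sum_const, nsmul_eq_mul]
    ring
  rw [Finset.sum_congr rfl h, Finset.sum_add_distrib, Finset.sum_sub_distrib, ← Finset.mul_sum,
    ← Finset.mul_sum, Finset.sum_const, nsmul_eq_mul]
  ring

/-- By Cauchy–Schwarz `v` takes at most two consecutive values on `R`, say with k vertices at the
upper one, and the sum is 2k(N - k). Bessel gives k(N - k) ≤ N, and equality has no integer solution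
for N ≥ 5; gaining this 1 is the point. -/
theorem IsSimplex.sum_form_sq_le {R : Finset L.carrier} (hR : IsSimplex R) (h5 : 5 ≤ R.card)
    {v : L.carrier} (hv : L.form v v = 1) :
    ∑ x ∈ R, ∑ y ∈ R, L.form v (x - y) ^ 2 ≤ 2 * (R.card - 1) := by
  classical
  obtain ⟨c, U, hUR, hvc⟩ := exists_indicator (R := R) (v := v) fun x hx y hy => by
    by_cases hxy : x = y
    · simp [hxy]
    · have h := form_sq_le v (x - y)
      rw [hv, hR x hx y hy hxy, map_sub] at h
      nlinarith
  have hle := hR.card_mul_card_sub_le hUR hvc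
  have hcl : (U.card : ℤ) ≤ R.card := by exact_mod_cast Finset.card_le_card hUR
  have h5' : (5 : ℤ) ≤ R.card := by exact_mod_cast h5
  have hU0 : (0 : ℤ) ≤ U.card := by positivity
  rw [hv, mul_one] at hle
  set k : ℤ := (U.card : ℤ) with hk
  set N : ℤ := (R.card : ℤ) with hN
  have hkN : k * (N - k) ≤ N - 1 := by
    by_contra hgt
    have heq : k * (N - k) = N := by omega
    have : k = 0 ∨ k = 1 ∨ k = N ∨ k = N - 1 ∨ (2 ≤ k ∧ 2 ≤ N - k) := by omega
    rcases this with h | h | h | h | ⟨h, h'⟩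
    · rw [h] at heq; linarith
    · rw [h] at heq; linarith
    · rw [h] at heq; linarith
    · rw [h] at heq; linarith
    · nlinarith [mul_nonneg (sub_nonneg.mpr h) (sub_nonneg.mpr h')]
  have h1 : ∀ x ∈ R, ∀ y ∈ R, L.form v (x - y) ^ 2
      = ((if x ∈ U then (1 : ℤ) else 0) - if y ∈ U then 1 else 0) ^ 2 := fun x hx y hy => by
    rw [map_sub, hvc x hx, hvc y hy]; ring
  rw [Finset.sum_congr rfl fun x hx => Finset.sum_congr rfl fun y hy => h1 x hx y hy,
    sum_sum_sub_sq]
  have : ∀ x ∈ R, (if x ∈ U then (1 : ℤ) else 0) ^ 2 = if x ∈ U then 1 else 0 :=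
    fun x _ => by split_ifs <;> norm_num
  rw [Finset.sum_congr rfl this, sum_indicator_of_subset hUR, ← hk, ← hN]
  linarith

/-- The edges of a large simplex lie in the orthogonal complement of the vectors of norm one. -/
theorem IsOrthonormal.sub_mem_orth (hf : IsOrthonormal f) (hno : ¬ L.Represents (cubic (m + 1)))
    {R : Finset L.carrier} (hR : IsSimplex R) (h5 : 5 ≤ R.card) (hm : R.card = m + 1)
    {x y : L.carrier} (hx : x ∈ R) (hy : y ∈ R) : x - y ∈ orth f := by
  by_cases hxy : x = y
  · simp [hxy]
  refine (hf.root hno (hR x hx y hy hxy)).resolve_right fun h0 => ?_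
  have hproj : ∀ c ∈ R, proj f c = proj f x := fun c hc => by
    by_cases hxc : x = c
    · rw [hxc]
    rw [eq_comm, ← sub_eq_zero, ← map_sub]
    by_cases hyc : y = c
    · rwa [← hyc]
    refine hf.root_of_root hno (hR x hx c hc hxc) ?_ h0
    rw [hR.form_sub_sub_of_ne hx hy hc hxy hxc hyc]
    exact one_ne_zero
  have hnorm : ∀ a ∈ R, ∀ b ∈ R, ∑ i, L.form (f i) (a - b) ^ 2 = L.form (a - b) (a - b) :=
    fun a ha b hb => by
      rw [hf.form_self_eq (a - b), map_sub (proj f), hproj a ha, hproj b hb]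
      simp
  -- Double count: if all edges lay in the span of `f`, the total would be (m + 1) · 2m, but each of
  -- the `m` unit vectors contributes at most 2m.
  have hleft : ∑ a ∈ R, ∑ b ∈ R, ∑ i, L.form (f i) (a - b) ^ 2 = (m + 1) * (2 * m) := by
    classical
    have : ∀ a ∈ R, ∑ b ∈ R, ∑ i, L.form (f i) (a - b) ^ 2 = 2 * m := fun a ha => by
      rw [← Finset.add_sum_erase R _ ha]
      have : ∀ b ∈ R.erase a, ∑ i, L.form (f i) (a - b) ^ 2 = 2 := fun b hb => by
        rw [hnorm a ha b (Finset.mem_of_mem_erase hb),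
          hR a ha b (Finset.mem_of_mem_erase hb) (Finset.ne_of_mem_erase hb).symm]
      rw [Finset.sum_congr rfl this, Finset.sum_const, Finset.card_erase_of_mem ha, hm]
      simp [mul_comm]
    rw [Finset.sum_congr rfl this, Finset.sum_const, hm]
    simp
  have hright : ∑ a ∈ R, ∑ b ∈ R, ∑ i, L.form (f i) (a - b) ^ 2 ≤ m * (2 * m) := by
    have : ∑ a ∈ R, ∑ b ∈ R, ∑ i, L.form (f i) (a - b) ^ 2
        = ∑ i, ∑ a ∈ R, ∑ b ∈ R, L.form (f i) (a - b) ^ 2 := by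
      rw [Finset.sum_comm]
      rw [Finset.sum_congr rfl fun b _ => Finset.sum_comm, Finset.sum_comm]
      exact Finset.sum_congr rfl fun i _ => Finset.sum_comm
    rw [this]
    have hi : ∀ i ∈ Finset.univ, ∑ a ∈ R, ∑ b ∈ R, L.form (f i) (a - b) ^ 2 ≤ 2 * (m : ℤ) :=
      fun i _ => by
        have := hR.sum_form_sq_le h5 (v := f i) (by simp [hf i i])
        rw [hm] at this
        simpa using this
    simpa using Finset.sum_le_sum hi
  have h4 : 4 ≤ m := by omega
  have : (4 : ℤ) ≤ m := by exact_mod_cast h4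
  nlinarith

/-! ### The image of D_n -/

theorem eq_zero_of_two_smul {x : L.carrier} (h : (2 : ℤ) • x = 0) : x = 0 := by
  apply eq_zero_of_form_self_nonpos
  have := congrArg (fun y => L.form y y) h
  simp only [map_smul, LinearMap.smul_apply, smul_eq_mul, map_zero] at this
  linarith

theorem mem_orth_of_two_smul {x : L.carrier} (h : (2 : ℤ) • x ∈ orth f) : x ∈ orth f := by
  rw [mem_orth] at h ⊢
  intro i
  have := h i
  rw [map_smul, smul_eq_mul] at this
  linarith

theorem exists_ne_ne (hm : 2 ≤ m) (i j : Fin (m + 1)) : ∃ k, k ≠ i ∧ k ≠ j := by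
  by_contra! h
  have hsub : (Finset.univ : Finset (Fin (m + 1))) ⊆ {i, j} := fun k _ => by
    by_cases hk : k = i
    · simp [hk]
    · simp [h k hk]
  have := (Finset.card_le_card hsub).trans Finset.card_le_two
  simp at this
  omega

/-- The vector `e i + s * e j`. -/
def rootD (i j : Fin (m + 1)) (s : ℤ) : Fin (m + 1) → ℤ := Pi.single i 1 + Pi.single j s

theorem rootD_mem {i j : Fin (m + 1)} {s : ℤ} (hs : s = 1 ∨ s = -1) :
    rootD i j s ∈ sumEven (m + 1) := by
  change Even (∑ l, (Pi.single i 1 + Pi.single j s : Fin (m + 1) → ℤ) l)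
  simp only [Pi.add_apply, Finset.sum_add_distrib, Finset.sum_pi_single', Finset.mem_univ, if_true]
  rcases hs with rfl | rfl <;> decide

theorem sum_rootD_mul {i j : Fin (m + 1)} (s : ℤ) (x : Fin (m + 1) → ℤ) :
    ∑ l, rootD i j s l * x l = x i + s * x j := by
  simp [rootD, add_mul, Finset.sum_add_distrib, Pi.single_apply]

theorem IsOrthonormal.latticeD_mem_orth (hf : IsOrthonormal f)
    (hno : ¬ L.Represents (cubic (m + 1))) (hm : 1 ≤ m)
    {σ : (latticeD (m + 1)).carrier →ₗ[ℤ] L.carrier}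
    (hσ : ∀ x, L.form (σ x) (σ x) = (latticeD (m + 1)).form x x) (x) : σ x ∈ orth f := by
  have hform : ∀ x y : sumEven (m + 1), L.form (σ x) (σ y) = ∑ i, x.1 i * y.1 i := fun x y => by
    rw [form_map hσ]; simp
  have htwo : ∀ x : Fin (m + 1) → ℤ, (2 : ℤ) • x ∈ sumEven (m + 1) := fun x => by
    change Even (∑ i, ((2 : ℤ) • x) i)
    simp [← Finset.mul_sum]
  -- Composing with doubling gives a map `τ` on all of ℤⁿ, which can be tested on the standard
  -- basis.
  let dbl : (Fin (m + 1) → ℤ) →ₗ[ℤ] sumEven (m + 1) :=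
    LinearMap.codRestrict _ ((2 : ℤ) • LinearMap.id) htwo
  let τ : (Fin (m + 1) → ℤ) →ₗ[ℤ] L.carrier := σ.comp dbl
  have hτ : ∀ x : sumEven (m + 1), τ x.1 = (2 : ℤ) • σ x := fun x => by
    rw [← map_smul]
    rfl
  have hgood : ∀ x : sumEven (m + 1), proj f (τ x.1) = 0 ↔ proj f (σ x) = 0 := fun x => by
    rw [hτ, map_smul]
    exact ⟨eq_zero_of_two_smul, fun h => by rw [h, smul_zero]⟩
  obtain ⟨i₁, i₀, h01⟩ : ∃ i j : Fin (m + 1), i ≠ j :=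
    ⟨0, Fin.last m, by simp [Fin.ext_iff]; omega⟩
  have hother : ∀ i : Fin (m + 1), ∃ j, i ≠ j := fun i => by
    by_cases h : i = i₁
    · exact ⟨i₀, by rwa [h]⟩
    · exact ⟨i₁, h⟩
  have hsplit : ∀ i j : Fin (m + 1), (2 : ℤ) • (Pi.single i 1 : Fin (m + 1) → ℤ)
      = rootD i j 1 + rootD i j (-1) := fun i j => by
    simp only [rootD, Pi.single_neg]
    module
  have hnorm : ∀ i j : Fin (m + 1), i ≠ j → ∀ s : ℤ, ∀ hs : s = 1 ∨ s = -1,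
      L.form (σ ⟨rootD i j s, rootD_mem hs⟩) (σ ⟨rootD i j s, rootD_mem hs⟩) = 2 := by
    intro i j hij s hs
    rw [hform, sum_rootD_mul]
    rcases hs with rfl | rfl <;> simp [rootD, hij, hij.symm]
  by_cases hex : ∃ i j : Fin (m + 1), i ≠ j ∧ ∃ s : ℤ, ∃ hs : s = 1 ∨ s = -1,
      proj f (τ (rootD i j s)) = 0
  · exfalso
    obtain ⟨i, j, hij, s, hs, h⟩ := hex
    -- The roots of D_2 are not connected, but there a root in the span of the single unit vector
    -- would make 2 a square.
    rcases (by omega : m = 1 ∨ 2 ≤ m) with rfl | hm2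
    · have h1 := hf.form_self_eq (σ ⟨rootD i j s, rootD_mem hs⟩)
      rw [(hgood ⟨_, rootD_mem hs⟩).mp h, hnorm i j hij s hs] at h1
      simp at h1
      set c := L.form (f 0) (σ ⟨rootD i j s, rootD_mem hs⟩)
      have : c < 2 := by nlinarith
      have : -2 < c := by nlinarith
      interval_cases c <;> omega
    · have step : ∀ i j k : Fin (m + 1), i ≠ j → i ≠ k → j ≠ k → ∀ s s' : ℤ,
          (s = 1 ∨ s = -1) → (s' = 1 ∨ s' = -1) → proj f (τ (rootD i j s)) = 0 →
          proj f (τ (rootD i k s')) = 0 := by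
        intro i j k hij hik hjk s s' hs hs' h
        refine (hgood ⟨_, rootD_mem hs'⟩).mpr ?_
        refine hf.root_of_root hno (hnorm i k hik s' hs') ?_ ((hgood ⟨_, rootD_mem hs⟩).mp h)
        rw [hform, sum_rootD_mul]
        simp [rootD, hij.symm, hik, hjk]
      -- The roots e_i + e_j and e_i - e_j are orthogonal; a third index links them.
      have step' : ∀ i j k : Fin (m + 1), i ≠ j → i ≠ k → ∀ s s' : ℤ,
          (s = 1 ∨ s = -1) → (s' = 1 ∨ s' = -1) → proj f (τ (rootD i j s)) = 0 →
          proj f (τ (rootD i k s')) = 0 := by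
        intro i j k hij hik s s' hs hs' h
        by_cases hjk : j = k
        · subst hjk
          obtain ⟨l, hli, hlj⟩ := exists_ne_ne hm2 i j
          exact step i l j hli.symm hij hlj 1 s' (.inl rfl) hs'
            (step i j l hij hli.symm hlj.symm s 1 hs (.inl rfl) h)
        · exact step i j k hij hik hjk s s' hs hs' h
      have hall : ∀ k l : Fin (m + 1), k ≠ l → ∀ s' : ℤ, (s' = 1 ∨ s' = -1) →
          proj f (τ (rootD k l s')) = 0 := by
        intro k l hkl s' hs'
        by_cases hki : i = k
        · subst hki
          exact step' i j l hij hkl s s' hs hs' h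
        · have h1 := step' i j k hij hki s 1 hs (.inl rfl) h
          rw [show rootD i k 1 = rootD k i 1 from add_comm _ _] at h1
          exact step' k i l (Ne.symm hki) hkl 1 s' (.inl rfl) hs' h1
      have hzero : (proj f).comp τ = 0 := by
        apply LinearMap.pi_ext'
        intro k
        apply LinearMap.ext_ring
        obtain ⟨l, hkl⟩ := hother k
        apply eq_zero_of_two_smul
        simp only [LinearMap.comp_apply]
        rw [← map_smul, ← map_smul]
        change proj f (τ ((2 : ℤ) • (Pi.single k 1 : Fin (m + 1) → ℤ))) = 0
        rw [hsplit k l, map_add, map_add, hall k l hkl 1 (.inl rfl), hall k l hkl (-1) (.inr rfl),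
          add_zero]
      have hinj : Function.Injective
          (LinearMap.pi fun a => (L.form (f a)).comp τ : (Fin (m + 1) → ℤ) →ₗ[ℤ] (Fin m → ℤ)) := by
        rw [← LinearMap.ker_eq_bot, LinearMap.ker_eq_bot']
        intro x hx
        have h1 := hf.form_self_eq (τ x)
        rw [show proj f (τ x) = 0 from LinearMap.congr_fun hzero x] at h1
        have h2 : ∀ a, L.form (f a) (τ x) = 0 := fun a => congrFun hx a
        simp only [h2, map_zero] at h1
        have h3 : L.form (τ x) (τ x) = ∑ i, ((2 : ℤ) • x) i * ((2 : ℤ) • x) i := hform _ _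
        rw [h1] at h3
        have h4 := (Finset.sum_eq_zero_iff_of_nonneg
          (fun i _ => mul_self_nonneg (((2 : ℤ) • x) i))).mp (by simpa using h3.symm)
        funext i
        simpa using h4 i (Finset.mem_univ i)
      have := LinearMap.finrank_le_finrank_of_injective hinj
      simp at this
  · have hall : ∀ k l : Fin (m + 1), k ≠ l → ∀ s : ℤ, (s = 1 ∨ s = -1) →
        τ (rootD k l s) ∈ orth f := by
      intro k l hkl s hs
      rw [hτ ⟨_, rootD_mem hs⟩]
      refine Submodule.smul_mem _ _ ((hf.root hno (hnorm k l hkl s hs)).resolve_right fun h => ?_)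
      exact hex ⟨k, l, hkl, s, hs, (hgood ⟨_, rootD_mem hs⟩).mpr h⟩
    have hτmem : ∀ y, τ y ∈ orth f := by
      intro y
      rw [show y = ∑ i, y i • (Pi.single i 1 : Fin (m + 1) → ℤ) by
        funext l; simp [Pi.single_apply], map_sum]
      refine Submodule.sum_mem _ fun k _ => ?_
      rw [map_smul]
      refine Submodule.smul_mem _ _ (mem_orth_of_two_smul ?_)
      obtain ⟨l, hkl⟩ := hother k
      rw [← map_smul, hsplit k l, map_add]
      exact Submodule.add_mem _ (hall k l hkl 1 (.inl rfl)) (hall k l hkl (-1) (.inr rfl))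
    apply mem_orth_of_two_smul
    rw [← hτ]
    exact hτmem _

/-! ### The images of A_{n-1} and their glue -/

/-- The vector `e i - e 0`. -/
def edge (i : Fin (m + 1)) : Fin (m + 1) → ℤ := Pi.single i 1 - Pi.single 0 1

theorem edge_mem (i : Fin (m + 1)) : edge i ∈ sumZero (m + 1) := by
  change ∑ l, (Pi.single i 1 - Pi.single 0 1 : Fin (m + 1) → ℤ) l = 0
  simp [Finset.sum_sub_distrib]

theorem eq_sum_edge {x : Fin (m + 1) → ℤ} (hx : x ∈ sumZero (m + 1)) :
    x = ∑ i, x i • edge i := by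
  have h0 : ∑ i, x i = 0 := hx
  simp only [edge, smul_sub, Finset.sum_sub_distrib, ← Finset.sum_smul, h0, zero_smul, sub_zero]
  funext l
  simp [Pi.single_apply]

theorem sum_mul_edge_sub (x : Fin (m + 1) → ℤ) (i j : Fin (m + 1)) :
    ∑ l, x l * (edge i l - edge j l) = x i - x j := by
  simp [edge, mul_sub, Finset.sum_sub_distrib, Pi.single_apply]

/-- The vertices are the images of e_i - e_0, and the glue vector is the projected image of the
indicator of `U`; projecting only lowers its norm and does not change its products with `orth f`.
The ambient lattice becomes `orth f`, where norm 1 does not occur. -/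
theorem IsOrthonormal.exists_simplex (hf : IsOrthonormal f)
    (hno : ¬ L.Represents (cubic (m + 1))) (hm : 4 ≤ m) {N : Submodule ℤ (Fin (m + 1) → ℤ)}
    (hN : sumZero (m + 1) ≤ N) {σ : N →ₗ[ℤ] L.carrier}
    (hσ : ∀ x, L.form (σ x) (σ x) = ∑ i, x.1 i * x.1 i) {U : Finset (Fin (m + 1))}
    (hU : (fun i => if i ∈ U then 1 else 0) ∈ N) :
    ∃ r : Fin (m + 1) → (L.sublattice (orth f)).carrier, ∃ P : Finset _, ∃ w,
      IsSimplex P ∧ P.card = m + 1 ∧ IsGlue P U.card w ∧ (∀ i, r i ∈ P) ∧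
      ∀ x, ∀ hx : x ∈ sumZero (m + 1),
        σ ⟨x, hN hx⟩ = ∑ i, x i • ((r i - r 0 : orth f) : L.carrier) := by
  classical
  have hform : ∀ x y : N, L.form (σ x) (σ y) = ∑ i, x.1 i * y.1 i := fun x y => by
    rw [form_map (M := (cubic (m + 1)).sublattice N) (σ := σ) (fun x => by rw [hσ]; simp)]
    simp
  set v : Fin (m + 1) → L.carrier := fun i => σ ⟨edge i, hN (edge_mem i)⟩ with hv
  have hv0 : v 0 = 0 := by
    have : (⟨edge 0, hN (edge_mem 0)⟩ : N) = 0 := Subtype.ext (by simp [edge])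
    simp only [hv]
    rw [this, map_zero]
  have hpair : ∀ x : N, ∀ i j, L.form (σ x) (v i - v j) = x.1 i - x.1 j := fun x i j => by
    simp only [hv]
    rw [← map_sub, hform, ← sum_mul_edge_sub x.1 i j]
    rfl
  have hdist : ∀ i j, i ≠ j → L.form (v i - v j) (v i - v j) = 2 := fun i j hij => by
    have : v i - v j = σ (⟨edge i, hN (edge_mem i)⟩ - ⟨edge j, hN (edge_mem j)⟩) := by
      rw [map_sub]
    nth_rewrite 1 [this]
    rw [hpair]
    simp [edge, Pi.single_apply, hij, hij.symm]
    ring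
  have hvinj : Function.Injective v := fun i j h => by
    by_contra hij
    have := hdist i j hij
    rw [h] at this
    simp at this
  have hsimp : IsSimplex (Finset.univ.image v) := by
    intro x hx y hy hxy
    obtain ⟨i, -, rfl⟩ := Finset.mem_image.mp hx
    obtain ⟨j, -, rfl⟩ := Finset.mem_image.mp hy
    exact hdist i j fun h => hxy (by rw [h])
  have hcard : (Finset.univ.image v).card = m + 1 := by
    rw [Finset.card_image_of_injective _ hvinj]; simp
  have hmem : ∀ i, v i ∈ orth f := fun i => by
    have := hf.sub_mem_orth hno hsimp (by omega) hcard
      (Finset.mem_image_of_mem v (Finset.mem_univ i)) (Finset.mem_image_of_mem v (Finset.mem_univ 0))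
    rwa [hv0, sub_zero] at this
  set r : Fin (m + 1) → (L.sublattice (orth f)).carrier := fun i => ⟨v i, hmem i⟩ with hr
  have hrinj : Function.Injective r := fun i j h => hvinj (congrArg Subtype.val h)
  set u : N := ⟨_, hU⟩ with hu
  refine ⟨r, Finset.univ.image r, ⟨proj f (σ u), hf.proj_mem _⟩, ?_, ?_, ⟨?_, ?_⟩, ?_, ?_⟩
  · intro x hx y hy hxy
    obtain ⟨i, -, rfl⟩ := Finset.mem_image.mp hx
    obtain ⟨j, -, rfl⟩ := Finset.mem_image.mp hy
    exact hdist i j fun h => hxy (by rw [h])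
  · rw [Finset.card_image_of_injective _ hrinj]; simp
  · change L.form (proj f (σ u)) (proj f (σ u)) ≤ _
    have h1 := hf.form_self_eq (σ u)
    have h2 : 0 ≤ ∑ i, L.form (f i) (σ u) ^ 2 := Finset.sum_nonneg fun _ _ => sq_nonneg _
    have h3 : L.form (σ u) (σ u) = U.card := by
      rw [hσ]
      simp [hu]
    linarith
  -- The constant is the contribution of the base vertex e_0 in e_i - e_0.
  · refine ⟨-(if (0 : Fin (m + 1)) ∈ U then 1 else 0), U.image r,
      Finset.image_subset_image (Finset.subset_univ _), Finset.card_image_of_injective _ hrinj, ?_⟩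
    intro x hx
    obtain ⟨i, -, rfl⟩ := Finset.mem_image.mp hx
    change L.form (proj f (σ u)) (v i) = _
    rw [form_proj_left _ (hmem i), ← sub_zero (v i), ← hv0, hpair]
    simp only [hrinj.mem_finset_image, hu]
    ring
  · exact fun i => Finset.mem_image_of_mem r (Finset.mem_univ i)
  · intro x hx
    have hx' : (⟨x, hN hx⟩ : N) = ∑ i, x i • ⟨edge i, hN (edge_mem i)⟩ := by
      apply Subtype.ext
      simp only [Submodule.coe_sum, Submodule.coe_smul]
      exact eq_sum_edge hx
    rw [hx', map_sum]
    refine Finset.sum_congr rfl fun i _ => ?_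
    rw [map_smul]
    change _ = x i • (v i - v 0)
    rw [hv0, sub_zero]

theorem IsOrthonormal.mem_orth_of_sumZero (hf : IsOrthonormal f)
    (hno : ¬ L.Represents (cubic (m + 1))) (hm : 4 ≤ m) {N : Submodule ℤ (Fin (m + 1) → ℤ)}
    (hN : sumZero (m + 1) ≤ N) {σ : N →ₗ[ℤ] L.carrier}
    (hσ : ∀ x, L.form (σ x) (σ x) = ∑ i, x.1 i * x.1 i) {x : Fin (m + 1) → ℤ}
    (hx : x ∈ sumZero (m + 1)) : σ ⟨x, hN hx⟩ ∈ orth f := by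
  obtain ⟨r, -, -, -, -, -, -, h⟩ := hf.exists_simplex hno hm hN hσ (U := ∅)
    (by
      simp only [Finset.notMem_empty, if_false]
      exact N.zero_mem)
  rw [h x hx]
  exact Submodule.sum_mem _ fun i _ => Submodule.smul_mem _ _ (Subtype.coe_prop _)

theorem IsOrthonormal.form_eq_zero_of_coprime (hf : IsOrthonormal f)
    (hno : ¬ L.Represents (cubic (m + 1))) {p q : ℕ} (hp : Odd p) (hp3 : 3 ≤ p) (hq : 2 ≤ q)
    (hpq : p.Coprime q) (hp2 : 2 * p ^ 2 < m + 1) (hq2 : 2 * q ^ 2 < m + 1)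
    {N N' : Submodule ℤ (Fin (m + 1) → ℤ)} (hN : sumZero (m + 1) ≤ N) (hN' : sumZero (m + 1) ≤ N')
    {σ : N →ₗ[ℤ] L.carrier} (hσ : ∀ x, L.form (σ x) (σ x) = ∑ i, x.1 i * x.1 i)
    {σ' : N' →ₗ[ℤ] L.carrier} (hσ' : ∀ x, L.form (σ' x) (σ' x) = ∑ i, x.1 i * x.1 i)
    {U U' : Finset (Fin (m + 1))} (hU : (fun i => if i ∈ U then 1 else 0) ∈ N)
    (hU' : (fun i => if i ∈ U' then 1 else 0) ∈ N') (hUp : U.card = p) (hUq : U'.card = q)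
    {x y : Fin (m + 1) → ℤ} (hx : x ∈ sumZero (m + 1)) (hy : y ∈ sumZero (m + 1)) :
    L.form (σ' ⟨y, hN' hy⟩) (σ ⟨x, hN hx⟩) = 0 := by
  have hm : 4 ≤ m := by nlinarith
  obtain ⟨r, P, w, hP, hPc, hw, hrP, h⟩ := hf.exists_simplex hno hm hN hσ hU
  obtain ⟨r', P', w', hP', hPc', hw', hrP', h'⟩ := hf.exists_simplex hno hm hN' hσ' hU'
  rw [h x hx, h' y hy]
  simp only [map_sum, LinearMap.sum_apply, map_smul, LinearMap.smul_apply]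
  refine Finset.sum_eq_zero fun i _ => ?_
  rw [Finset.smul_sum]
  refine Finset.sum_eq_zero fun j _ => ?_
  have hL : ∀ x : (L.sublattice (orth f)).carrier, (L.sublattice (orth f)).form x x ≠ 1 :=
    fun x => hf.form_self_ne_one hno x.2
  have := IsSimplex.orthogonal hL hP hP' hp hp3 hq hpq (by rwa [hPc]) (by rwa [hPc])
    (hPc'.trans hPc.symm) (hUp ▸ hw) (hUq ▸ hw') (hrP i) (hrP 0) (hrP' j) (hrP' 0)
  change L.form ((r' j - r' 0 : orth f) : L.carrier) ((r i - r 0 : orth f) : L.carrier) = 0 at this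
  rw [this]
  simp

/-! ### D_n against A_{n-1} -/

/-- The reflection of `ℤⁿ` in the first coordinate. -/
def reflection (m : ℕ) : (Fin (m + 1) → ℤ) →ₗ[ℤ] (Fin (m + 1) → ℤ) :=
  LinearMap.id - (LinearMap.proj 0).smulRight (Pi.single 0 2)

theorem reflection_apply (x : Fin (m + 1) → ℤ) (i : Fin (m + 1)) :
    reflection m x i = x i - if i = 0 then 2 * x 0 else 0 := by
  simp [reflection, Pi.single_apply, mul_comm]

theorem reflection_mem {x : Fin (m + 1) → ℤ} (hx : x ∈ sumEven (m + 1)) :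
    reflection m x ∈ sumEven (m + 1) := by
  have h : Even (∑ i, x i) := hx
  change Even (∑ i, reflection m x i)
  simp only [reflection_apply, Finset.sum_sub_distrib, Finset.sum_ite_eq', Finset.mem_univ, if_true]
  exact h.sub (even_two_mul _)

theorem sum_reflection_mul_self (x : Fin (m + 1) → ℤ) :
    ∑ i, reflection m x i * reflection m x i = ∑ i, x i * x i := by
  refine Finset.sum_congr rfl fun i _ => ?_
  rw [reflection_apply]
  split_ifs with h
  · subst h; ring
  · ring

theorem sumZero_le_sumEven : sumZero (m + 1) ≤ sumEven (m + 1) := by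
  intro x hx
  have h : ∑ i, x i = 0 := hx
  change Even (∑ i, x i)
  simp [h]

theorem two_smul_eq_add_reflection (hm : 1 ≤ m) (y : Fin (m + 1) → ℤ) :
    ∃ a ∈ sumZero (m + 1), ∃ b ∈ sumZero (m + 1), (2 : ℤ) • y = a + reflection m b := by
  have hl : Fin.last m ≠ 0 := by simp [Fin.ext_iff]; omega
  set a : Fin (m + 1) → ℤ := ∑ i, y i • edge i with ha
  have hmem : a ∈ sumZero (m + 1) :=
    Submodule.sum_mem _ fun i _ => Submodule.smul_mem _ _ (edge_mem i)
  -- The vector `a` agrees with `y` off coordinate 0. The multiples of the last edge cancel at the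
  -- last coordinate, while the reflection makes them add up at coordinate 0.
  refine ⟨a - y 0 • edge (Fin.last m), Submodule.sub_mem _ hmem
    (Submodule.smul_mem _ _ (edge_mem _)), a + y 0 • edge (Fin.last m), Submodule.add_mem _ hmem
    (Submodule.smul_mem _ _ (edge_mem _)), ?_⟩
  have hav : ∀ i, a i = y i - if i = 0 then ∑ l, y l else 0 := fun i => by
    simp [ha, edge, mul_sub, Finset.sum_sub_distrib, Pi.single_apply]
  funext i
  simp only [Pi.add_apply, Pi.sub_apply, Pi.smul_apply, reflection_apply, hav, smul_eq_mul, edge,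
    Pi.single_apply, hl.symm, if_true, if_false]
  by_cases h : i = 0
  · subst h; simp [hl.symm]; ring
  · simp [h]; ring

/-- The coprime case for `p` and 2 applies to `σ'` and to `σ'` composed with the reflection, both
with glue e_0 + e_m; together they control the image of 2y. -/
theorem IsOrthonormal.latticeD_form_eq_zero (hf : IsOrthonormal f)
    (hno : ¬ L.Represents (cubic (m + 1))) {p : ℕ} (hp : Odd p) (hp3 : 3 ≤ p)
    (hp2 : 2 * p ^ 2 < m + 1) {N : Submodule ℤ (Fin (m + 1) → ℤ)} (hN : sumZero (m + 1) ≤ N)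
    {σ : N →ₗ[ℤ] L.carrier} (hσ : ∀ x, L.form (σ x) (σ x) = ∑ i, x.1 i * x.1 i)
    {σ' : sumEven (m + 1) →ₗ[ℤ] L.carrier}
    (hσ' : ∀ x, L.form (σ' x) (σ' x) = ∑ i, x.1 i * x.1 i)
    {U : Finset (Fin (m + 1))} (hU : (fun i => if i ∈ U then 1 else 0) ∈ N) (hUp : U.card = p)
    {x : Fin (m + 1) → ℤ} (hx : x ∈ sumZero (m + 1)) (y : sumEven (m + 1)) :
    L.form (σ' y) (σ ⟨x, hN hx⟩) = 0 := by
  have hm : 1 ≤ m := by nlinarith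
  have hq2 : 2 * 2 ^ 2 < m + 1 := by nlinarith
  obtain ⟨a, ha, b, hb, hy⟩ := two_smul_eq_add_reflection hm y.1
  have hl : (0 : Fin (m + 1)) ≠ Fin.last m := by simp [Fin.ext_iff]; omega
  have hU' : (fun i => if i ∈ ({0, Fin.last m} : Finset (Fin (m + 1))) then (1 : ℤ) else 0)
      ∈ sumEven (m + 1) := by
    change Even (∑ i : Fin (m + 1),
      if i ∈ ({0, Fin.last m} : Finset (Fin (m + 1))) then (1 : ℤ) else 0)
    rw [Finset.sum_ite_mem]
    simp [Finset.card_pair hl]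
  let ρ : sumEven (m + 1) →ₗ[ℤ] sumEven (m + 1) :=
    (reflection m).restrict fun x hx => reflection_mem hx
  have hρ : ∀ z, L.form ((σ'.comp ρ) z) ((σ'.comp ρ) z) = ∑ i, z.1 i * z.1 i := fun z => by
    rw [LinearMap.comp_apply, hσ', ← sum_reflection_mul_self z.1]
    rfl
  have h1 := hf.form_eq_zero_of_coprime hno hp hp3 le_rfl (Nat.coprime_two_right.mpr hp) hp2 hq2
    hN sumZero_le_sumEven hσ hσ' hU hU' hUp (Finset.card_pair hl) hx ha
  have h2 := hf.form_eq_zero_of_coprime hno hp hp3 le_rfl (Nat.coprime_two_right.mpr hp) hp2 hq2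
    hN sumZero_le_sumEven hσ hρ hU hU' hUp (Finset.card_pair hl) hx hb
  have h3 : (2 : ℤ) • y = ⟨a, sumZero_le_sumEven ha⟩ + ρ ⟨b, sumZero_le_sumEven hb⟩ :=
    Subtype.ext hy
  have h4 := congrArg (fun z => L.form (σ' z) (σ ⟨x, hN hx⟩)) h3
  rw [LinearMap.comp_apply] at h2
  simp only [map_smul, map_add, LinearMap.smul_apply, LinearMap.add_apply, smul_eq_mul, h1, h2]
    at h4
  linarith

/-! ### Assembling the orthogonal sum -/

/-- The vectors of `ℤⁿ` with coordinate sum divisible by `p`. -/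
def sumDvd (n p : ℕ) : Submodule ℤ (Fin n → ℤ) where
  carrier := {a | (p : ℤ) ∣ ∑ i, a i}
  add_mem' {a b} ha hb := by
    have ha : (p : ℤ) ∣ ∑ i, a i := ha
    have hb : (p : ℤ) ∣ ∑ i, b i := hb
    change (p : ℤ) ∣ ∑ i, (a + b) i
    simpa [Finset.sum_add_distrib] using ha.add hb
  zero_mem' := by
    change (p : ℤ) ∣ ∑ i, (0 : Fin n → ℤ) i
    simp
  smul_mem' c a ha := by
    have ha : (p : ℤ) ∣ ∑ i, a i := ha
    change (p : ℤ) ∣ ∑ i, (c • a) i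
    simpa [← Finset.mul_sum] using ha.mul_left c

theorem sumZero_le_sumDvd (n p : ℕ) : sumZero n ≤ sumDvd n p := by
  intro x hx
  have h : ∑ i, x i = 0 := hx
  change (p : ℤ) ∣ ∑ i, x i
  simp [h]

theorem sumDvd_ne_top {p : ℕ} (hp : 2 ≤ p) : sumDvd (m + 1) p ≠ ⊤ := by
  intro h
  have h1 : (Pi.single 0 1 : Fin (m + 1) → ℤ) ∈ sumDvd (m + 1) p := h ▸ Submodule.mem_top
  have h2 : (p : ℤ) ∣ ∑ i, (Pi.single 0 1 : Fin (m + 1) → ℤ) i := h1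
  rw [Finset.sum_pi_single'] at h2
  simp only [Finset.mem_univ, if_true] at h2
  have := Int.le_of_dvd one_pos h2
  omega

theorem sumEven_ne_top : sumEven (m + 1) ≠ ⊤ := by
  intro h
  have h1 : (Pi.single 0 1 : Fin (m + 1) → ℤ) ∈ sumEven (m + 1) := h ▸ Submodule.mem_top
  have h2 : Even (∑ i, (Pi.single 0 1 : Fin (m + 1) → ℤ) i) := h1
  rw [Finset.sum_pi_single'] at h2
  simp at h2

theorem IsIsolation.exists_isOrthonormal (h : IsIsolation (cubic (m + 1)) L) :
    ∃ f : Fin m → L.carrier, IsOrthonormal f := by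
  have hne : LinearMap.ker (LinearMap.proj (R := ℤ) (φ := fun _ => ℤ) (Fin.last m)) ≠ ⊤ := by
    intro h
    have h1 : (Pi.single (Fin.last m) 1 : Fin (m + 1) → ℤ) ∈
      LinearMap.ker (LinearMap.proj (R := ℤ) (φ := fun _ => ℤ) (Fin.last m)) :=
        h ▸ Submodule.mem_top
    simp at h1
  obtain ⟨σ, hσ⟩ := h.1 _ hne
  have hmem : ∀ i : Fin m, (Pi.single i.castSucc 1 : Fin (m + 1) → ℤ) ∈
      LinearMap.ker (LinearMap.proj (R := ℤ) (φ := fun _ => ℤ) (Fin.last m)) := fun i => by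
    simp [(Fin.castSucc_lt_last i).ne']
  refine ⟨fun i => σ ⟨_, hmem i⟩, fun i j => ?_⟩
  rw [form_map hσ]
  simp [Pi.single_apply, eq_comm]

theorem form_coprod {M M' : PosDefLattice} {σ : M.carrier →ₗ[ℤ] L.carrier}
    {τ : M'.carrier →ₗ[ℤ] L.carrier} (hσ : ∀ x, L.form (σ x) (σ x) = M.form x x)
    (hτ : ∀ x, L.form (τ x) (τ x) = M'.form x x) (h : ∀ x y, L.form (σ x) (τ y) = 0) (x) :
    L.form (σ.coprod τ x) (σ.coprod τ x) = (M.orthSum M').form x x := by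
  rw [LinearMap.coprod_apply, form_add_self, hσ, hτ, h]
  simp

theorem form_sum_proj {M : PosDefLattice} {s : ℕ} {σ : Fin s → M.carrier →ₗ[ℤ] L.carrier}
    (hσ : ∀ k x, L.form (σ k x) (σ k x) = M.form x x)
    (h : ∀ k l, k ≠ l → ∀ x y, L.form (σ k x) (σ l y) = 0) (x) :
    L.form ((∑ k, (σ k).comp (LinearMap.proj k) : (Fin s → M.carrier) →ₗ[ℤ] L.carrier) x)
      ((∑ k, (σ k).comp (LinearMap.proj k) : (Fin s → M.carrier) →ₗ[ℤ] L.carrier) x)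
      = (copies s M).form x x := by
  simp only [LinearMap.sum_apply, LinearMap.comp_apply, LinearMap.proj_apply, map_sum,
    LinearMap.compl₁₂_apply]
  refine Finset.sum_congr rfl fun k _ => ?_
  rw [Finset.sum_eq_single k (fun l _ hl => h l k hl _ _) (by simp), hσ]

/-- An isolation of a cubic lattice represents the orthogonal sum of a smaller cubic lattice, a
lattice of type `D`, and a lattice of type `A` for each small odd prime. -/
theorem IsIsolation.represents (hm : 1 ≤ m) (h : IsIsolation (cubic (m + 1)) L) {s : ℕ}
    {p : Fin s → ℕ} (hinj : Function.Injective p) (hp : ∀ k, (p k).Prime) (hp2 : ∀ k, p k ≠ 2)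
    (hpm : ∀ k, 2 * p k ^ 2 < m + 1) :
    L.Represents (((cubic m).orthSum (latticeD (m + 1))).orthSum (copies s (latticeA m))) := by
  obtain ⟨f, hf⟩ := h.exists_isOrthonormal
  obtain ⟨σD, hσD⟩ := h.1 (sumEven (m + 1)) sumEven_ne_top
  choose σ hσ using fun k => h.1 (sumDvd (m + 1) (p k)) (sumDvd_ne_top (hp k).two_le)
  have hodd : ∀ k, Odd (p k) := fun k => (hp k).odd_of_ne_two (hp2 k)
  have hp3 : ∀ k, 3 ≤ p k := fun k => by have := (hp k).two_le; have := hp2 k; omega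
  have hpl : ∀ k, p k ≤ m + 1 := fun k => by
    have := hpm k
    have := Nat.le_self_pow two_ne_zero (p k)
    omega
  choose U hU using fun k => Finset.exists_subset_card_eq
    (s := (Finset.univ : Finset (Fin (m + 1)))) (n := p k) (by simpa using hpl k)
  have hUm : ∀ k, (fun i => if i ∈ U k then (1 : ℤ) else 0) ∈ sumDvd (m + 1) (p k) := fun k => by
    change (p k : ℤ) ∣ ∑ i, if i ∈ U k then (1 : ℤ) else 0
    rw [Finset.sum_ite_mem]
    simp [(hU k).2]
  have hσ' : ∀ k x, L.form (σ k x) (σ k x) = ∑ i, x.1 i * x.1 i := fun k x => by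
    rw [hσ]; simp
  have hσD' : ∀ x, L.form (σD x) (σD x) = ∑ i, x.1 i * x.1 i := fun x => by rw [hσD]; simp
  let ι : ∀ k, sumZero (m + 1) →ₗ[ℤ] sumDvd (m + 1) (p k) := fun k =>
    Submodule.inclusion (sumZero_le_sumDvd (m + 1) (p k))
  let σA : Fin s → (latticeA m).carrier →ₗ[ℤ] L.carrier := fun k => (σ k).comp (ι k)
  let F : (cubic m).carrier →ₗ[ℤ] L.carrier := Fintype.linearCombination ℤ f
  have hF : ∀ x, L.form (F x) (F x) = (cubic m).form x x := fun x => by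
    simp only [F, Fintype.linearCombination_apply]
    exact hf.form_sum_self x
  have horth : ∀ x y, y ∈ orth f → L.form (F x) y = 0 := fun x y hy => by
    rw [mem_orth] at hy
    simp [F, Fintype.linearCombination_apply, map_sum, LinearMap.sum_apply, hy]
  refine ⟨(F.coprod σD).coprod (∑ k, (σA k).comp (LinearMap.proj k)), ?_⟩
  refine form_coprod (form_coprod hF hσD fun x y => horth x _ (hf.latticeD_mem_orth h.2 hm hσD y))
    (form_sum_proj (fun k x => ?_) fun k l hkl x y => ?_) fun x y => ?_
  · simp only [σA, LinearMap.comp_apply]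
    rw [hσ]
    rfl
  · exact hf.form_eq_zero_of_coprime h.2 (hodd l) (hp3 l) (hp k).two_le
      ((Nat.coprime_primes (hp l) (hp k)).mpr fun e => hkl (hinj e.symm)) (hpm l) (hpm k)
      (sumZero_le_sumDvd _ _) (sumZero_le_sumDvd _ _) (hσ' l) (hσ' k) (hUm l) (hUm k) (hU l).2
      (hU k).2 y.2 x.2
  · rw [LinearMap.sum_apply, map_sum]
    refine Finset.sum_eq_zero fun k _ => ?_
    have hm4 : 4 ≤ m := by nlinarith [hpm k, hp3 k]
    rw [LinearMap.coprod_apply, map_add, LinearMap.add_apply]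
    have h1 := horth x.1 _ (hf.mem_orth_of_sumZero h.2 hm4 (sumZero_le_sumDvd _ (p k)) (hσ' k) (y k).2)
    have h2 := hf.latticeD_form_eq_zero h.2 (hodd k) (hp3 k) (hpm k) (sumZero_le_sumDvd _ _)
      (hσ' k) hσD' (hUm k) (hU k).2 (y k).2 x.2
    exact (congrArg₂ (· + ·) h1 h2).trans (add_zero 0)

/-! ### Ranks, prime counting and growth -/

theorem Represents.rank_le {M : PosDefLattice} (h : L.Represents M) : M.rank ≤ L.rank := by
  obtain ⟨σ, hσ⟩ := h
  have hinj : Function.Injective σ := by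
    rw [← LinearMap.ker_eq_bot, LinearMap.ker_eq_bot']
    intro x hx
    apply eq_zero_of_form_self_nonpos
    rw [← hσ, hx]
    simp
  exact LinearMap.finrank_le_finrank_of_injective hinj

theorem le_rank_orthSum (m s : ℕ) :
    m + (m + 1) + s * m ≤
      (((cubic m).orthSum (latticeD (m + 1))).orthSum (copies s (latticeA m))).rank := by
  have htwo : ∀ x : Fin (m + 1) → ℤ, (2 : ℤ) • x ∈ sumEven (m + 1) := fun x => by
    change Even (∑ i, ((2 : ℤ) • x) i)
    simp [← Finset.mul_sum]
  let δ : (Fin (m + 1) → ℤ) →ₗ[ℤ] sumEven (m + 1) :=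
    LinearMap.codRestrict _ ((2 : ℤ) • LinearMap.id) htwo
  have hδ : Function.Injective δ := fun x y h => by
    have h' : (2 : ℤ) • x = (2 : ℤ) • y := congrArg Subtype.val h
    funext i
    simpa using congrFun h' i
  have hmem : ∀ x : Fin m → ℤ, (∑ i, x i • edge i.succ) ∈ sumZero (m + 1) := fun x =>
    Submodule.sum_mem _ fun i _ => Submodule.smul_mem _ _ (edge_mem _)
  let α : (Fin m → ℤ) →ₗ[ℤ] sumZero (m + 1) :=
    LinearMap.codRestrict _ (Fintype.linearCombination ℤ fun i : Fin m => edge i.succ) hmem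
  have hα : Function.Injective α := fun x y h => by
    have h' : ∑ i, x i • edge i.succ = ∑ i, y i • edge i.succ := congrArg Subtype.val h
    funext i
    simpa [edge, Pi.single_apply] using congrFun h' i.succ
  let Φ : (((Fin m → ℤ) × (Fin (m + 1) → ℤ)) × (Fin s → Fin m → ℤ)) →ₗ[ℤ]
      (((cubic m).orthSum (latticeD (m + 1))).orthSum (copies s (latticeA m))).carrier :=
    (LinearMap.id.prodMap δ).prodMap (LinearMap.pi fun k => α.comp (LinearMap.proj k))
  have hΦ : Function.Injective Φ := fun x y h => by
    have h1 : x.1.1 = y.1.1 := congrArg (fun z => z.1.1) h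
    have h2 : δ x.1.2 = δ y.1.2 := congrArg (fun z => z.1.2) h
    have h3 : ∀ k, α (x.2 k) = α (y.2 k) := fun k => congrArg (fun z => z.2 k) h
    exact Prod.ext (Prod.ext h1 (hδ h2)) (funext fun k => hα (h3 k))
  have := LinearMap.finrank_le_finrank_of_injective hΦ
  unfold rank
  refine le_trans (le_of_eq ?_) this
  simp [Module.finrank_pi_fintype]

/-- Discarding 2 costs at most one prime, and p < √(n/2) is exactly the bound 2p² < n needed for
glue to extend. -/
theorem exists_injective_odd_primes {n : ℕ} :
    ∃ p : Fin (Set.ncard {p : ℕ | p.Prime ∧ (p : ℝ) < √((n : ℝ) / 2)} - 1) → ℕ,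
      Function.Injective p ∧ (∀ k, (p k).Prime) ∧ (∀ k, p k ≠ 2) ∧ ∀ k, 2 * p k ^ 2 < n := by
  set S := {p : ℕ | p.Prime ∧ (p : ℝ) < √((n : ℝ) / 2)} with hS
  have hfin : S.Finite := by
    refine (Set.finite_Iio ⌈√((n : ℝ) / 2)⌉₊).subset fun p hp => ?_
    exact Nat.lt_ceil.mpr hp.2
  have hcard : S.ncard - 1 ≤ (hfin.toFinset.erase 2).card := by
    rw [Set.ncard_eq_toFinset_card S hfin]
    exact Finset.pred_card_le_card_erase
  obtain ⟨T, hT, hTc⟩ := Finset.exists_subset_card_eq hcard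
  refine ⟨T.orderEmbOfFin hTc, (T.orderEmbOfFin hTc).injective, ?_⟩
  have hmem : ∀ k, T.orderEmbOfFin hTc k ∈ S ∧ T.orderEmbOfFin hTc k ≠ 2 := fun k => by
    have := hT (T.orderEmbOfFin_mem hTc k)
    rw [Finset.mem_erase, Set.Finite.mem_toFinset] at this
    exact ⟨this.2, this.1⟩
  refine ⟨fun k => (hmem k).1.1, fun k => (hmem k).2, fun k => ?_⟩
  have h := (hmem k).1.2
  rw [Real.lt_sqrt (by positivity)] at h
  have : (2 * (T.orderEmbOfFin hTc k) ^ 2 : ℝ) < n := by linarith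
  exact_mod_cast this

theorem le_iso_cubic {n : ℕ} (hn : 1 < n) :
    ((2 * n - 1 + (n - 1) * (Set.ncard {p : ℕ | p.Prime ∧ (p : ℝ) < √((n : ℝ) / 2)} - 1) : ℕ) : ℕ∞)
      ≤ iso (cubic n) := by
  refine le_iInf fun L => le_iInf fun hL => ?_
  obtain ⟨m, rfl⟩ : ∃ m, n = m + 1 := ⟨n - 1, by omega⟩
  obtain ⟨p, hinj, hp, hp2, hpm⟩ := exists_injective_odd_primes (n := m + 1)
  have h1 := (hL.represents (by omega) hinj hp hp2 hpm).rank_le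
  have h2 := (le_rank_orthSum m _).trans h1
  rw [Nat.cast_le]
  refine le_trans (le_of_eq ?_) h2
  rw [Nat.add_sub_cancel, mul_comm m]
  omega

open Filter in
theorem eventually_rpow_le_primeCounting {δ : ℝ} (hδ : 0 < δ) :
    ∀ᶠ K : ℕ in atTop, (K : ℝ) ^ (1 - δ) ≤ Nat.primeCounting K := by
  have hlog : ∀ r : ℝ, 0 < r → ∀ c : ℝ, 0 < c → ∀ᶠ K : ℕ in atTop,
      Real.log K ≤ c * (K : ℝ) ^ r := fun r hr c hc => by
    have h := (isLittleO_log_rpow_atTop hr).bound hc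
    filter_upwards [tendsto_natCast_atTop_atTop.eventually h, eventually_ge_atTop 1] with K hK hK1
    rw [Real.norm_eq_abs, Real.norm_eq_abs, abs_of_nonneg (Real.rpow_nonneg (by positivity) _)]
      at hK
    exact (le_abs_self _).trans hK
  filter_upwards [hlog δ hδ (1 / 4) (by norm_num), hlog 1 one_pos (1 / 16) (by norm_num),
    eventually_ge_atTop 16] with K h1 h2 hK
  have hK' : (16 : ℝ) ≤ K := by exact_mod_cast hK
  have hKpos : (0 : ℝ) < K := by linarith
  have hlogpos : 0 < Real.log K := Real.log_pos (by linarith)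
  rw [Real.rpow_one] at h2
  have h3 : Real.log (K + 1) ≤ Real.log 2 + Real.log K := by
    rw [← Real.log_mul (by norm_num) hKpos.ne']
    exact Real.log_le_log (by linarith) (by linarith)
  have hl2 := Real.log_two_gt_d9
  have hl2' := Real.log_two_lt_d9
  -- This is the numerator of Chebyshev's lower bound; the factor 1/4 is absorbed by log K ≤ K^δ /
  -- 4.
  have h4 : (K : ℝ) / 4 ≤ K * Real.log 2 - Real.log (K + 1) := by nlinarith
  refine le_trans ?_ (Chebyshev.pi_ge K)
  rw [le_div_iff₀ hlogpos]
  calc (K : ℝ) ^ (1 - δ) * Real.log K ≤ (K : ℝ) ^ (1 - δ) * (1 / 4 * (K : ℝ) ^ δ) := by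
        gcongr
    _ = K / 4 := by
        rw [mul_left_comm, ← Real.rpow_add hKpos]
        simp; ring
    _ ≤ _ := h4

theorem primeCounting_sqrt_le {n : ℕ} (hn : 1 ≤ n) :
    Nat.primeCounting (Nat.sqrt ((n - 1) / 2))
      ≤ Set.ncard {p : ℕ | p.Prime ∧ (p : ℝ) < √((n : ℝ) / 2)} := by
  rw [← Nat.primesLE_card_eq_primeCounting, ← Set.ncard_coe_finset]
  refine Set.ncard_le_ncard (fun p hp => ?_) ?_
  · rw [Finset.mem_coe, Nat.mem_primesLE] at hp
    refine ⟨hp.2, ?_⟩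
    rw [Real.lt_sqrt (by positivity)]
    have h1 := Nat.le_sqrt'.mp hp.1
    have h2 : 2 * p ^ 2 < n := by omega
    have h3 : (2 * p ^ 2 : ℝ) < n := by exact_mod_cast h2
    linarith
  · refine (Set.finite_Iio ⌈√((n : ℝ) / 2)⌉₊).subset fun p hp => ?_
    exact Nat.lt_ceil.mpr hp.2

open Filter in
theorem iso_cubic_growth {ε : ℝ} (hε : 0 < ε) : ∃ C : ℝ, 0 < C ∧ ∀ᶠ n : ℕ in atTop,
    ENNReal.ofReal (C * (n : ℝ) ^ (3 / 2 - ε)) ≤ (iso (cubic n) : ENNReal) := by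
  -- Capping at 1/2 keeps the exponent (1 - δ)/2 nonnegative, and δ ≤ ε gives 3/2 - ε ≤ 1 + (1 -
  -- δ)/2.
  set δ : ℝ := min ε (1 / 2) with hδ
  have hδ0 : 0 < δ := lt_min hε (by norm_num)
  have hδε : δ ≤ ε := min_le_left _ _
  have hδ1 : δ ≤ 1 / 2 := min_le_right _ _
  refine ⟨1 / 2 * (1 / 8 : ℝ) ^ ((1 - δ) / 2), by positivity, ?_⟩
  have htend : Tendsto (fun n : ℕ => Nat.sqrt ((n - 1) / 2)) atTop atTop := by
    refine tendsto_atTop_atTop.mpr fun b => ⟨2 * b ^ 2 + 1, fun n hn => ?_⟩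
    rw [Nat.le_sqrt']
    omega
  filter_upwards [htend.eventually (eventually_rpow_le_primeCounting hδ0),
    htend.eventually (eventually_ge_atTop 1), eventually_ge_atTop 2] with n h1 hK hn
  set K := Nat.sqrt ((n - 1) / 2) with hKdef
  set t := Set.ncard {p : ℕ | p.Prime ∧ (p : ℝ) < √((n : ℝ) / 2)} with ht
  have hKt : Nat.primeCounting K ≤ t := primeCounting_sqrt_le (by omega)
  have h2 := le_iso_cubic (n := n) (by omega)
  rw [← ht] at h2
  -- The term 2n - 1 pays for the prime 2, and covers t = 0, where t - 1 truncates to 0.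
  have h3 : (n - 1) * t ≤ 2 * n - 1 + (n - 1) * (t - 1) := by
    rcases Nat.eq_zero_or_pos t with h | h
    · simp [h]
    · obtain ⟨u, hu⟩ : ∃ u, t = u + 1 := ⟨t - 1, by omega⟩
      rw [hu, Nat.add_sub_cancel, mul_add]
      omega
  have h4 : (((n - 1) * t : ℕ) : ℕ∞) ≤ iso (cubic n) := le_trans (by exact_mod_cast h3) h2
  have h5 : (((n - 1) * t : ℕ) : ENNReal) ≤ (iso (cubic n) : ENNReal) := by
    rw [← ENat.toENNReal_coe]
    exact ENat.toENNReal_le.mpr h4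
  refine le_trans ?_ h5
  rw [← ENNReal.ofReal_natCast]
  apply ENNReal.ofReal_le_ofReal
  have hn2 : (2 : ℝ) ≤ n := by exact_mod_cast hn
  have hsq : (n : ℝ) / 8 ≤ (K : ℝ) ^ 2 := by
    have h6 : (n - 1) / 2 < (K + 1) ^ 2 := Nat.lt_succ_sqrt' _
    have h7 : n ≤ 8 * K ^ 2 := by
      have : (K + 1) ^ 2 ≤ 4 * K ^ 2 := by nlinarith
      omega
    have : (n : ℝ) ≤ 8 * (K : ℝ) ^ 2 := by exact_mod_cast h7
    linarith
  have hKr : ((n : ℝ) / 8) ^ ((1 - δ) / 2) ≤ (K : ℝ) ^ (1 - δ) := by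
    calc ((n : ℝ) / 8) ^ ((1 - δ) / 2) ≤ ((K : ℝ) ^ 2) ^ ((1 - δ) / 2) :=
          Real.rpow_le_rpow (by positivity) hsq (by linarith)
      _ = (K : ℝ) ^ (1 - δ) := by
          rw [← Real.rpow_natCast, ← Real.rpow_mul (by positivity)]
          congr 1
          push_cast
          ring
  have htr : (K : ℝ) ^ (1 - δ) ≤ t := h1.trans (by exact_mod_cast hKt)
  have hn1 : ((n - 1 : ℕ) : ℝ) = n - 1 := by rw [Nat.cast_sub (by omega)]; simp
  rw [Nat.cast_mul, hn1]
  calc 1 / 2 * (1 / 8 : ℝ) ^ ((1 - δ) / 2) * (n : ℝ) ^ (3 / 2 - ε)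
      ≤ 1 / 2 * (1 / 8 : ℝ) ^ ((1 - δ) / 2) * (n : ℝ) ^ (1 + (1 - δ) / 2) := by
        gcongr
        · linarith
        · linarith
    _ = (n : ℝ) / 2 * ((n : ℝ) / 8) ^ ((1 - δ) / 2) := by
        rw [Real.rpow_add (by linarith), Real.rpow_one, div_eq_mul_one_div (n : ℝ) 8,
          Real.mul_rpow (by positivity) (by positivity)]
        ring
    _ ≤ (n - 1) * t := by
        gcongr
        · linarith
        · linarith
        · exact hKr.trans htr

end PosDefLattice

theorem mainTheorem3 :
    (∀ n : ℕ, 1 < n →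
      ∀ t : ℕ, t = Set.ncard {p : ℕ | p.Prime ∧ (p : ℝ) < √((n : ℝ) / 2)} →
        (∀ L : PosDefLattice, PosDefLattice.IsIsolation (PosDefLattice.cubic n) L →
          L.Represents
            (((PosDefLattice.cubic (n - 1)).orthSum (PosDefLattice.latticeD n)).orthSum
              (PosDefLattice.copies (t - 1) (PosDefLattice.latticeA (n - 1))))) ∧
        ((2 * n - 1 + (n - 1) * (t - 1) : ℕ) : ℕ∞) ≤
          PosDefLattice.iso (PosDefLattice.cubic n)) ∧
    (∀ ε : ℝ, 0 < ε → ∃ C : ℝ, 0 < C ∧ ∀ᶠ n : ℕ in Filter.atTop,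
      ENNReal.ofReal (C * (n : ℝ) ^ (3 / 2 - ε)) ≤
        (PosDefLattice.iso (PosDefLattice.cubic n) : ENNReal)) := by
  refine ⟨fun n hn t ht => ⟨fun L hL => ?_, ?_⟩, fun ε hε => PosDefLattice.iso_cubic_growth hε⟩
  · subst ht
    obtain ⟨p, hinj, hp, hp2, hpm⟩ := PosDefLattice.exists_injective_odd_primes (n := n)
    revert p
    generalize Set.ncard {p : ℕ | p.Prime ∧ (p : ℝ) < √((n : ℝ) / 2)} - 1 = s
    intro p hinj hp hp2 hpm
    obtain ⟨m, rfl⟩ : ∃ m, n = m + 1 := ⟨n - 1, by omega⟩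
    exact hL.represents (by omega) hinj hp hp2 hpm
  · subst ht
    exact PosDefLattice.le_iso_cubic hn
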